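/- **Setting.** Let $c,\varphi_c,T_s,\sigma>0$, $\lambda_c=c/\varphi_c$, $d=\lambda_c/2$, let $K\ge 0$, $N,N_t\ge 2$ be integers, and let $\Delta_\tau,\Delta_\theta\in\mathbb R$. For $t_1<t_2$ put $(x)_{(t_1,t_2]}=x-m(t_2-t_1)$, where $m$ is the integer for which the result lies in $(t_1,t_2]$. Eve is at $z\in\mathbb R^2$. Locations are tuples $\phi=(p,v_1,\dots,v_K)\in(\mathbb R^2)^{K+1}$ (Alice's position $p$ and $K$ scatterers); put $v_0=z$. For $k=0,\dots,K$, $$\tau_k(\phi)=\frac{\|v_0-v_k\|_2+\|p-v_k\|_2}{c},\qquad \theta_k(\phi)=\arctan\frac{v_{k,y}-p_y}{v_{k,x}-p_x},$$ and the shifted parameters are $$\bar\tau_k(\phi)=(\tau_k(\phi)+\Delta_\tau)_{(0,NT_s]},\qquad \bar\theta_k(\phi)=\arcsin\big((\sin\theta_k(\phi)+\sin\Delta_\theta)_{(-1,1]}\big).$$ Call $\phi$ *frontal* if $p_x<v_{k,x}$ for all $k=0,\dots,K$. Write $u(\phi)=(\bar\tau_k(\phi),\bar\theta_k(\phi))_{k}$.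 The true locations $\phi^\star=(p^\star,v_1^\star,\dots,v_K^\star)$ are frontal; $\tau^\star_k,\theta^\star_k,\bar\tau_k,\bar\theta_k$ without argument refer to $\phi^\star$. Assume that $\cos\bar\theta_k\ne0$ for all $k$, that $\bar\tau_k$ has a unique minimizer $k_{\min}$, and that the path coefficients $\gamma_0,\dots,\gamma_K\in\mathbb C$ are nonzero. **Fisher information.** The pilot signals $s^{(g,n)}\in\mathbb C^{N_t}$ ($g\ge1$, $0\le n<N$) are random, for each $n$ independent and identically distributed over $g$, with $\mathbb E\|s^{(g,n)}\|^2<\infty$ and $\mathbb E[s^{(g,n)}(s^{(g,n)})^{\mathrm H}]=\frac1{N_t}I$. With $\alpha(\theta)=(e^{-j2\pi m d\sin\theta/\lambda_c})_{0\le m<N_t}$ let $$\varpi^{(g,n)}=\sum_{k=0}^K\gamma_k e^{-j2\pi n\bar\tau_k/(NT_s)}\alpha(\bar\theta_k)^{\mathrm H}s^{(g,n)} ,\qquad \bar\xi=(\bar\tau,\bar\theta,\operatorname{Re}\gamma,\operatorname{Im}\gamma)\in\mathbb R^{4(K+1)},$$ $$J^{(G)}=\frac2{\sigma^2}\sum_{n=0}^{N-1}\sum_{g=1}^{G}\operatorname{Re}\Big\{\Big(\frac{\partial\varpi^{(g,n)}}{\partial\bar\xi}\Big)^{*}\frac{\partial\varpi^{(g,n)}}{\partial\bar\xi}\Big\}=\begin{pmatrix}J_1&J_2\\J_3&J_4\end{pmatrix},\qquad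 \Sigma_G=\big(J_1-J_2J_4^{-1}J_3\big)^{-1},$$ with blocks of size $2(K+1)$ (delays and angles first). The paths are *orthogonal* for $G$ pilots if every entry of $J^{(G)}$ between a parameter of path $k$ and a parameter of path $k'\neq k$ is $0$. **Eve's localization.** Given the pilots, when the true locations are $\phi$, Eve's channel estimate $\hat\eta$ is distributed as $\mathcal N(u(\phi),\Sigma_G)$, with $\Sigma_G$ computed at $\phi^\star$. Taking the path $k=k(\phi)$ with the (unique) smallest shifted delay $\bar\tau_k(\phi)$ for the line-of-sight path, she believes that $\hat\eta\sim\mathcal N(o_k(\bar\phi),\Sigma_G)$ for some frontal $\bar\phi$, where $o_k(\bar\phi)=(\tau_{\pi(i)}(\bar\phi),\theta_{\pi(i)}(\bar\phi))_{i}$ and $\pi$ exchanges $0$ and $k$. *Pseudo-true locations* for $\phi$ are the minimizers over frontal $\bar\phi$ of $\mathrm{KL}\big(\mathcal N(u(\phi),\Sigma_G)\,\|\,\mathcal N(o_k(\bar\phi),\Sigma_G)\big)$. A measurable function $\hat p=\hat p(\hat\eta)\in\mathbb R^2$ is *misspecified-unbiased* if for all $\phi$ in some neighbourhood of $\phi^\star$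 its mean under $\mathcal N(u(\phi),\Sigma_G)$ exists and equals Alice's pseudo-true position for $\phi$ (whenever pseudo-true locations for $\phi$ exist). **Claim.** For every real $\psi>0$, with probability $1$ (over the pilots) there is a positive integer $\mathcal G$ such that for every $G\ge\mathcal G$ for which the paths are orthogonal: $J^{(G)}$ is positive definite; there are unique pseudo-true locations $(\bar p^\star,\bar v_1^\star,\dots,\bar v_K^\star)$ for $\phi^\star$; and every misspecified-unbiased $\hat p$ satisfies, with the expectation taken over $\hat\eta\sim\mathcal N(u(\phi^\star),\Sigma_G)$, $$\mathbb E\|\hat p-p^\star\|_2^2\ \ge\ C_1+\frac{C_2\,\bar\tau_{k_{\min}}^2}{\cos^2\bar\theta_{k_{\min}}}+\|\bar p^\star-p^\star\|_2^2 ,$$ where $$C_1=\frac{3\sigma^2c^2NT_s^2}{2G|\gamma_{k_{\min}}|^2\pi^2(N^2-1)}-\frac\psi G,\qquad C_2=\frac{3\sigma^2c^2\lambda_c^2}{2G|\gamma_{k_{\min}}|^2\pi^2d^2N(N_t^2-1)} .$$ Moreover, writing $D=(\tau^\star_{k_{\min}}+\Delta_\tau)_{(0,NT_s]}$ and $S=(\sin\theta^\star_{k_{\min}}+\sin\Delta_\theta)_{(-1,1]}$,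 the right-hand side equals $$C_1+\frac{C_2D^2}{\cos^2(\arcsin S)}+\big(z_x-p_x^\star-cD\cos(\arcsin S)\big)^2+\big(z_y-p_y^\star-cDS\big)^2 .$$ -/

import Mathlib

open MeasureTheory ProbabilityTheory Filter Topology
open scoped Matrix ENNReal ComplexConjugate

noncomputable section

namespace DAIS

/-- The Euclidean plane. -/
abbrev Plane : Type := EuclideanSpace ℝ (Fin 2)

/-- Locations `φ = (p, v₁, …, v_K)`: entry `0` is Alice's position, entry `k ≥ 1` is the position of
the `k`-th scatterer. -/
abbrev Locations (K : ℕ) : Type := Fin (K + 1) → Plane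

/-- Index set of the location-relevant channel parameters `η = [τ; θ]`:
`inl k` is the delay (TOA) and `inr k` the angle (AOD) of path `k = 0, …, K`. -/
abbrev EtaIdx (K : ℕ) : Type := Fin (K + 1) ⊕ Fin (K + 1)

/-- Index set of all channel parameters `ξ = [τ; θ; Re γ; Im γ]`. -/
abbrev XiIdx (K : ℕ) : Type := EtaIdx K ⊕ (Fin (K + 1) ⊕ Fin (K + 1))

/-- The path to which a channel parameter belongs. -/
def pathOf {K : ℕ} : XiIdx K → Fin (K + 1) :=
  Sum.elim (Sum.elim id id) (Sum.elim id id)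

/-- `(x)_{(a,b]} = x - ⌊(x-a)/(b-a)⌋ (b-a)`, where `⌊y⌋` is the largest integer strictly less than
`y`, that is, `⌈y⌉ - 1`. -/
def wrap (a b x : ℝ) : ℝ := x - ((⌈(x - a) / (b - a)⌉ : ℝ) - 1) * (b - a)

/-- The wrapped value lies in `(a, b]`. -/
theorem wrap_mem_Ioc {a b : ℝ} (h : a < b) (x : ℝ) : wrap a b x ∈ Set.Ioc a b := by
  have hb : 0 < b - a := sub_pos.2 h
  have h1 := Int.le_ceil ((x - a) / (b - a))
  have h2 := Int.ceil_lt_add_one ((x - a) / (b - a))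
  rw [div_le_iff₀ hb] at h1
  rw [← sub_lt_iff_lt_add, lt_div_iff₀ hb] at h2
  unfold wrap
  constructor <;> nlinarith

/-- Wrapping changes the value by an integer number of periods. -/
theorem exists_wrap_eq (a b x : ℝ) : ∃ m : ℤ, wrap a b x = x - m * (b - a) :=
  ⟨⌈(x - a) / (b - a)⌉ - 1, by simp [wrap]⟩

/-- The physical and design parameters of Eve's channel, with `K` non-line-of-sight paths. -/
structure Model (K : ℕ) where
  /-- speed of light -/
  c : ℝ
  /-- carrier frequency -/
  carrier : ℝ
  /-- sampling period -/
  Ts : ℝ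
  /-- standard deviation of the receiver noise -/
  sigma : ℝ
  c_pos : 0 < c
  carrier_pos : 0 < carrier
  Ts_pos : 0 < Ts
  sigma_pos : 0 < sigma
  /-- Eve's position -/
  z : Plane
  /-- complex coefficients of the paths -/
  gain : Fin (K + 1) → ℂ
  /-- the delay shift -/
  shiftDelay : ℝ
  /-- the angle shift -/
  shiftAngle : ℝ

namespace Model

variable {K : ℕ} (M : Model K)

/-- Carrier wavelength. -/
def wavelength : ℝ := M.c / M.carrier

/-- Distance between antennas: half a wavelength. -/
def spacing : ℝ := M.wavelength / 2

/-! ### Geometry -/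

/-- The point towards which the `k`-th path leaves Alice: the receiver Eve for the line-of-sight
path `k = 0`, the `k`-th scatterer otherwise. -/
def node (φ : Locations K) (k : Fin (K + 1)) : Plane := if k = 0 then M.z else φ k

/-- Time of arrival of the `k`-th path. -/
def toa (φ : Locations K) (k : Fin (K + 1)) : ℝ :=
  (‖M.node φ 0 - M.node φ k‖ + ‖φ 0 - M.node φ k‖) / M.c

/-- Angle of departure of the `k`-th path. -/
def aod (φ : Locations K) (k : Fin (K + 1)) : ℝ :=
  Real.arctan ((M.node φ k 1 - φ 0 1) / (M.node φ k 0 - φ 0 0))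

/-- Eve and all scatterers are in front of Alice's antenna array, so that `aod` is the direction
in which the path leaves Alice. -/
def InFront (φ : Locations K) : Prop := ∀ k, φ 0 0 < M.node φ k 0

/-- The shifted delay of the `k`-th path, with `N` sub-carriers. -/
def shiftedToa (N : ℕ) (φ : Locations K) (k : Fin (K + 1)) : ℝ :=
  wrap 0 (N * M.Ts) (M.toa φ k + M.shiftDelay)

/-- The shifted angle of the `k`-th path. -/
def shiftedAod (φ : Locations K) (k : Fin (K + 1)) : ℝ :=
  Real.arcsin (wrap (-1) 1 (Real.sin (M.aod φ k) + Real.sin M.shiftAngle))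

/-- The true map `u` from the locations to the channel parameters that Eve observes. -/
def trueMap (N : ℕ) (φ : Locations K) : EuclideanSpace ℝ (EtaIdx K) :=
  WithLp.toLp 2 (Sum.elim (M.shiftedToa N φ) (M.shiftedAod φ))

/-- The map `o` from the locations to the channel parameters that Eve believes in when she takes
path `k` for the line-of-sight path: path `k` then plays the role of path `0` and vice versa. -/
def perceivedMap (k : Fin (K + 1)) (φ : Locations K) : EuclideanSpace ℝ (EtaIdx K) :=
  WithLp.toLp 2 (Sum.elim (fun j => M.toa φ (Equiv.swap 0 k j))
    (fun j => M.aod φ (Equiv.swap 0 k j)))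

/-- `k` is the (unique) path with the smallest shifted delay. -/
def IsFirstPath (N : ℕ) (φ : Locations K) (k : Fin (K + 1)) : Prop :=
  ∀ j, j ≠ k → M.shiftedToa N φ k < M.shiftedToa N φ j

/-! ### Virtual channel and Fisher information -/

/-- Steering vector of the `Nt` antennas. -/
def steering (Nt : ℕ) (θ : ℝ) (m : Fin Nt) : ℂ :=
  Complex.exp (-Complex.I * ((2 * Real.pi * (m : ℕ) * M.spacing * Real.sin θ / M.wavelength : ℝ) : ℂ))

/-- The channel row vector of sub-carrier `n` with channel parameters `ξ`. -/
def channel (N Nt : ℕ) (ξ : XiIdx K → ℝ) (n : Fin N) (m : Fin Nt) : ℂ :=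
  ∑ k : Fin (K + 1),
    ((ξ (.inr (.inl k)) : ℂ) + (ξ (.inr (.inr k)) : ℂ) * Complex.I) *
      Complex.exp (-Complex.I *
        ((2 * Real.pi * (n : ℕ) * ξ (.inl (.inl k)) / (N * M.Ts) : ℝ) : ℂ)) *
      conj (M.steering Nt (ξ (.inl (.inr k))) m)

/-- The noise-free observation of the pilot signal `s` on sub-carrier `n`. -/
def observation (N Nt : ℕ) (ξ : XiIdx K → ℝ) (n : Fin N) (s : Fin Nt → ℂ) : ℂ :=
  ∑ m, M.channel N Nt ξ n m * s m

/-- Partial derivative of the noise-free observation with respect to the channel parameter `i`. -/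
def dObservation (N Nt : ℕ) (ξ : XiIdx K → ℝ) (n : Fin N) (s : Fin Nt → ℂ) (i : XiIdx K) : ℂ :=
  deriv (fun t : ℝ => M.observation N Nt (Function.update ξ i t) n s) (ξ i)

/-- The Fisher information matrix of the channel parameters after `G` pilot signals
(`s g n` is the `g`-th pilot signal on sub-carrier `n`). -/
def fisher (N Nt : ℕ) (ξ : XiIdx K → ℝ) (s : ℕ → Fin N → Fin Nt → ℂ) (G : ℕ) :
    Matrix (XiIdx K) (XiIdx K) ℝ :=
  Matrix.of fun i j => 2 / M.sigma ^ 2 * ∑ n : Fin N, ∑ g ∈ Finset.range G,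
    (conj (M.dObservation N Nt ξ n (s g n) i) * M.dObservation N Nt ξ n (s g n) j).re

/-- The channel parameters of Eve's virtual channel: shifted delays and angles, and the path
coefficients. -/
def virtualParams (N : ℕ) (φ : Locations K) : XiIdx K → ℝ :=
  Sum.elim (Sum.elim (M.shiftedToa N φ) (M.shiftedAod φ))
    (Sum.elim (fun k => (M.gain k).re) (fun k => (M.gain k).im))

/-- The Fisher information matrix of the virtual channel. -/
def virtualFisher (N Nt : ℕ) (φ : Locations K) (s : ℕ → Fin N → Fin Nt → ℂ) (G : ℕ) :
    Matrix (XiIdx K) (XiIdx K) ℝ :=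
  M.fisher N Nt (M.virtualParams N φ) s G

/-- Path orthogonality: the Fisher information between parameters of different paths vanishes. -/
def PathsOrthogonal (N Nt : ℕ) (φ : Locations K) (s : ℕ → Fin N → Fin Nt → ℂ) (G : ℕ) : Prop :=
  ∀ i j : XiIdx K, pathOf i ≠ pathOf j → M.virtualFisher N Nt φ s G i j = 0

/-- The effective Fisher information matrix of the delays and angles, the path coefficients being
nuisance parameters. -/
def effectiveFisher (N Nt : ℕ) (φ : Locations K) (s : ℕ → Fin N → Fin Nt → ℂ) (G : ℕ) :
    Matrix (EtaIdx K) (EtaIdx K) ℝ :=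
  let J := M.virtualFisher N Nt φ s G
  J.toBlocks₁₁ - J.toBlocks₁₂ * J.toBlocks₂₂⁻¹ * J.toBlocks₂₁

/-- The covariance matrix of the error of an efficient estimate of the delays and angles. -/
def errorCov (N Nt : ℕ) (φ : Locations K) (s : ℕ → Fin N → Fin Nt → ℂ) (G : ℕ) :
    Matrix (EtaIdx K) (EtaIdx K) ℝ :=
  (M.effectiveFisher N Nt φ s G)⁻¹

/-! ### Eve's localization -/

/-- True law of Eve's channel estimate: `u(φ) + ε` with `ε` centred Gaussian with covariance `S`. -/
def trueLaw (N : ℕ) (S : Matrix (EtaIdx K) (EtaIdx K) ℝ) (φ : Locations K) :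
    Measure (EuclideanSpace ℝ (EtaIdx K)) :=
  multivariateGaussian (M.trueMap N φ) S

/-- Law of the channel estimate that Eve believes in: `o(φ) + ε`, with the same noise `ε`. -/
def perceivedLaw (k : Fin (K + 1)) (S : Matrix (EtaIdx K) (EtaIdx K) ℝ) (φ : Locations K) :
    Measure (EuclideanSpace ℝ (EtaIdx K)) :=
  multivariateGaussian (M.perceivedMap k φ) S

/-- `ψ` are pseudo-true locations when the true locations are `φ`: Eve takes the path with the
smallest shifted delay for the line-of-sight path, and `ψ` minimizes the Kullback-Leibler divergence
of the law she believes in from the true law. -/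
def IsPseudoTrue (N : ℕ) (S : Matrix (EtaIdx K) (EtaIdx K) ℝ) (φ ψ : Locations K) : Prop :=
  ∃ k, M.IsFirstPath N φ k ∧ M.InFront ψ ∧
    IsMinOn (fun χ => InformationTheory.klDiv (M.trueLaw N S φ) (M.perceivedLaw k S χ))
      {χ | M.InFront χ} ψ

/-- The position estimator `e`, a function of Eve's channel estimate, is misspecified-unbiased
around the true locations `φ`: its mean under the true law is Alice's pseudo-true position,
for all true locations in a neighbourhood of `φ`. -/
def MisspecifiedUnbiased (N : ℕ) (S : Matrix (EtaIdx K) (EtaIdx K) ℝ) (φ : Locations K)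
    (e : EuclideanSpace ℝ (EtaIdx K) → Plane) : Prop :=
  ∀ᶠ χ in 𝓝 φ, ∀ ψ, M.IsPseudoTrue N S χ ψ →
    Integrable e (M.trueLaw N S χ) ∧ ∫ x, e x ∂(M.trueLaw N S χ) = ψ 0

/-- Mean squared error of the position estimator `e` when the true locations are `φ`. -/
def mse (N : ℕ) (S : Matrix (EtaIdx K) (EtaIdx K) ℝ) (φ : Locations K)
    (e : EuclideanSpace ℝ (EtaIdx K) → Plane) : ℝ≥0∞ :=
  ∫⁻ x, ‖e x - φ 0‖ₑ ^ 2 ∂(M.trueLaw N S φ)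

/-- The constant `C₁`, for the first path `k`. -/
def C₁ (N : ℕ) (k : Fin (K + 1)) (G : ℕ) (ψ : ℝ) : ℝ :=
  3 * M.sigma ^ 2 * M.c ^ 2 * N * M.Ts ^ 2 /
      (2 * G * ‖M.gain k‖ ^ 2 * Real.pi ^ 2 * ((N : ℝ) ^ 2 - 1)) - ψ / G

/-- The constant `C₂`, for the first path `k`. -/
def C₂ (N Nt : ℕ) (k : Fin (K + 1)) (G : ℕ) : ℝ :=
  3 * M.sigma ^ 2 * M.c ^ 2 * M.wavelength ^ 2 /
    (2 * G * ‖M.gain k‖ ^ 2 * Real.pi ^ 2 * M.spacing ^ 2 * N * ((Nt : ℝ) ^ 2 - 1))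

end Model

/-- Random pilot signals (`s g n ω` is the `g`-th one on sub-carrier `n`): on every sub-carrier they
are independent and identically distributed, with `E[s sᴴ] = I / Nt`. -/
structure IsPilotSequence {Ω : Type*} [MeasurableSpace Ω] (P : Measure Ω) {N Nt : ℕ}
    (s : ℕ → Fin N → Ω → Fin Nt → ℂ) : Prop where
  measurable : ∀ g n, Measurable (s g n)
  indep : ∀ n, iIndepFun (fun g => s g n) P
  identDistrib : ∀ g n, IdentDistrib (s g n) (s 0 n) P P
  memLp : ∀ g n m, MemLp (fun ω => s g n ω m) 2 P
  secondMoment : ∀ g n (m m' : Fin Nt),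
    ∫ ω, s g n ω m * conj (s g n ω m') ∂P = if m = m' then 1 / (Nt : ℂ) else 0

end DAIS

end

/-! Eve's wrong model can fit the shifted channel exactly. A frontal configuration whose
line-of-sight path is strictly the shortest is determined by its delays and angles: Alice lies at
distance `c τ₀` from Eve in direction `θ₀`, and each scatterer is the point where a ray from Alice
meets an ellipse with foci Alice and Eve. The inverse map is `locate`. Applied to the shifted
parameters, with the first path in the role of path `0`, it gives `explained`, where the
Kullback–Leibler divergence vanishes. A zero divergence forces equal Gaussian means, so the
pseudo-true locations are unique and Alice's pseudo-true position is `z - c D dir θ`, with `D`, `θ`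
the shifted delay and angle of the first path.

The mean squared error about `p⋆` is the error about the pseudo-true mean plus the squared bias. The
first error is split along `dir θ` and its normal. Changing `D` moves the pseudo-true position
radially at rate `c`; changing `θ` moves it tangentially at rate `c D`. A one-parameter information
inequality in each direction (`sq_le_of_variation`) gives `c² / F_DD + (c D)² / F_θθ`, with `F` the
effective information matrix. It comes from the Chapman–Robbins inequality for Gaussian shifts,
letting the shift tend to zero, so no regularity of the estimator beyond measurability is needed.
The true locations realizing these changes exist by `exists_delay_variation` and
`exists_angle_variation`.

It remains to bound the diagonal of `F` from above. A Schur complement minimizes the quadratic form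
over the nuisance parameters, so any choice of gain direction gives an upper bound
(`schur_apply_le`). By the strong law the averaged form converges; the direction that centres the
index of the sub-carrier or antenna yields the constants of `C₁` and `C₂`, and `ψ` absorbs the error
of the limit (`eventually_bound_le`). Path orthogonality enters through positive definiteness
(`eventually_posDef`): it decouples the quadratic form into single paths, each of which is
identifiable. -/

namespace DAIS

/-! ### Chapman–Robbins inequality for Gaussian location families -/

/-- The Cauchy–Schwarz inequality for square-integrable real functions. -/
theorem sq_integral_mul_le {α : Type*} [MeasurableSpace α] {μ : Measure α} {f g : α → ℝ}
    (hf : MemLp f 2 μ) (hg : MemLp g 2 μ) :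
    (∫ x, f x * g x ∂μ) ^ 2 ≤ (∫ x, f x ^ 2 ∂μ) * ∫ x, g x ^ 2 ∂μ := by
  have hfg : Integrable (fun x => f x * g x) μ := hf.integrable_mul hg
  have h : ∀ t : ℝ, 0 ≤ (∫ x, f x ^ 2 ∂μ) * (t * t) + (2 * ∫ x, f x * g x ∂μ) * t
      + ∫ x, g x ^ 2 ∂μ := fun t => by
    have h0 : 0 ≤ ∫ x, (t * f x + g x) ^ 2 ∂μ := integral_nonneg fun x => sq_nonneg _
    have e : (fun x => (t * f x + g x) ^ 2)
        = fun x => (t * t) * f x ^ 2 + (2 * t) * (f x * g x) + g x ^ 2 := by funext x; ring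
    rw [e, integral_add, integral_add, integral_const_mul, integral_const_mul] at h0
    · linarith
    · exact hf.integrable_sq.const_mul _
    · exact hfg.const_mul _
    · exact (hf.integrable_sq.const_mul _).add (hfg.const_mul _)
    · exact hg.integrable_sq
  have := discrim_le_zero h
  rw [discrim] at this
  linarith

section Gaussian

open scoped RealInnerProductSpace

variable {ι : Type*} [Fintype ι]

/-- The exponential moments of the standard Gaussian measure, with complex exponents. -/
theorem integral_cexp_stdGaussian (w : ι → ℂ) :
    ∫ x : EuclideanSpace ℝ ι, Complex.exp (∑ i, w i * x i) ∂stdGaussian (EuclideanSpace ℝ ι)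
      = Complex.exp (∑ i, w i ^ 2 / 2) := by
  rw [← map_pi_eq_stdGaussian, integral_map (by fun_prop)
    (Measurable.aestronglyMeasurable (by fun_prop))]
  simp_rw [Complex.exp_sum]
  rw [integral_fintype_prod_eq_prod (f := fun i (x : ℝ) ↦ Complex.exp (w i * x))]
  refine Finset.prod_congr rfl fun i _ => ?_
  have := complexMGF_id_gaussianReal (μ := 0) (v := 1) (w i)
  simpa [complexMGF] using this

theorem integrable_exp_inner_stdGaussian (a : EuclideanSpace ℝ ι) :
    Integrable (fun x => Real.exp ⟪a, x⟫) (stdGaussian (EuclideanSpace ℝ ι)) := by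
  have h := integral_cexp_stdGaussian (fun i => (a i : ℂ))
  have h2 : Integrable (fun x : EuclideanSpace ℝ ι => Complex.exp (∑ i, (a i : ℂ) * x i))
      (stdGaussian (EuclideanSpace ℝ ι)) := by
    -- A non-integrable function has Bochner integral `0` by convention, whereas the computed value
    -- is an exponential.
    by_contra hc
    rw [integral_undef hc] at h
    exact Complex.exp_ne_zero _ h.symm
  refine h2.re.congr (ae_of_all _ fun x => ?_)
  have : (∑ i, (a i : ℂ) * x i) = ((⟪a, x⟫ : ℝ) : ℂ) := by
    simp [PiLp.inner_apply, mul_comm]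
  simp only [this, ← Complex.ofReal_exp, RCLike.re_to_complex, Complex.ofReal_re]

theorem integral_exp_inner_stdGaussian (a : EuclideanSpace ℝ ι) :
    ∫ x, Real.exp ⟪a, x⟫ ∂stdGaussian (EuclideanSpace ℝ ι) = Real.exp (‖a‖ ^ 2 / 2) := by
  have h := integral_cexp_stdGaussian (fun i => (a i : ℂ))
  have h1 : ∀ x : EuclideanSpace ℝ ι, (∑ i, (a i : ℂ) * x i) = ((⟪a, x⟫ : ℝ) : ℂ) := fun x => by
    simp [PiLp.inner_apply, mul_comm]
  have h2 : ∑ i, (a i : ℂ) ^ 2 / 2 = ((‖a‖ ^ 2 / 2 : ℝ) : ℂ) := by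
    rw [EuclideanSpace.real_norm_sq_eq]; push_cast; rw [Finset.sum_div]
  simp only [h1, h2, ← Complex.ofReal_exp, integral_complex_ofReal] at h
  exact_mod_cast h

/-- The density of a translate of the standard Gaussian measure. -/
noncomputable def gaussianShift (a x : EuclideanSpace ℝ ι) : ℝ := Real.exp (⟪a, x⟫ - ‖a‖ ^ 2 / 2)

theorem gaussianShift_nonneg (a x : EuclideanSpace ℝ ι) : 0 ≤ gaussianShift a x :=
  (Real.exp_pos _).le

theorem continuous_gaussianShift (a : EuclideanSpace ℝ ι) : Continuous (gaussianShift a) := by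
  unfold gaussianShift; fun_prop

theorem gaussianShift_eq (a x : EuclideanSpace ℝ ι) :
    gaussianShift a x = Real.exp (-(‖a‖ ^ 2 / 2)) * Real.exp ⟪a, x⟫ := by
  rw [gaussianShift, sub_eq_neg_add, Real.exp_add]

theorem integrable_gaussianShift (a : EuclideanSpace ℝ ι) :
    Integrable (gaussianShift a) (stdGaussian (EuclideanSpace ℝ ι)) := by
  simp only [funext (gaussianShift_eq a)]
  exact (integrable_exp_inner_stdGaussian a).const_mul _

theorem integral_gaussianShift (a : EuclideanSpace ℝ ι) :
    ∫ x, gaussianShift a x ∂stdGaussian (EuclideanSpace ℝ ι) = 1 := by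
  simp only [gaussianShift_eq, integral_const_mul, integral_exp_inner_stdGaussian]
  rw [← Real.exp_add]; simp

theorem gaussianShift_sq (a x : EuclideanSpace ℝ ι) :
    gaussianShift a x ^ 2 = Real.exp (-‖a‖ ^ 2) * Real.exp ⟪(2 : ℝ) • a, x⟫ := by
  rw [gaussianShift, ← Real.exp_nat_mul, ← Real.exp_add, real_inner_smul_left]
  congr 1; push_cast; ring

theorem integrable_gaussianShift_sq (a : EuclideanSpace ℝ ι) :
    Integrable (fun x => gaussianShift a x ^ 2) (stdGaussian (EuclideanSpace ℝ ι)) := by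
  simp only [gaussianShift_sq]
  exact (integrable_exp_inner_stdGaussian _).const_mul _

theorem integral_gaussianShift_sq (a : EuclideanSpace ℝ ι) :
    ∫ x, gaussianShift a x ^ 2 ∂stdGaussian (EuclideanSpace ℝ ι) = Real.exp (‖a‖ ^ 2) := by
  simp only [gaussianShift_sq, integral_const_mul, integral_exp_inner_stdGaussian]
  rw [← Real.exp_add, norm_smul]; congr 1; norm_num; ring

/-- The Cameron–Martin formula. Both measures are finite, so comparing characteristic functions
suffices; that of the tilted measure is a Gaussian exponential moment with complex exponent `a + i
t`. -/
theorem map_const_add_stdGaussian (a : EuclideanSpace ℝ ι) :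
    (stdGaussian (EuclideanSpace ℝ ι)).map (fun x => a + x)
      = (stdGaussian (EuclideanSpace ℝ ι)).withDensity
          (fun x => ENNReal.ofReal (gaussianShift a x)) := by
  have hm : Measurable (gaussianShift a) := (continuous_gaussianShift a).measurable
  have : IsFiniteMeasure ((stdGaussian (EuclideanSpace ℝ ι)).withDensity
      (fun x => ENNReal.ofReal (gaussianShift a x))) :=
    isFiniteMeasure_withDensity_ofReal (integrable_gaussianShift a).2
  have : IsFiniteMeasure ((stdGaussian (EuclideanSpace ℝ ι)).map (fun x => a + x)) :=
    Measure.isFiniteMeasure_map _ _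
  refine Measure.ext_of_charFun (funext fun t => ?_)
  rw [charFun_map_const_add, charFun_stdGaussian, charFun_apply,
    integral_withDensity_eq_integral_toReal_smul hm.ennreal_ofReal (by simp)]
  have h1 : ∀ x : EuclideanSpace ℝ ι,
      (ENNReal.ofReal (gaussianShift a x)).toReal • Complex.exp (⟪x, t⟫ * Complex.I)
        = Complex.exp (-(‖a‖ ^ 2 / 2 : ℝ))
          * Complex.exp (∑ i, ((a i : ℂ) + t i * Complex.I) * x i) := fun x => by
    rw [ENNReal.toReal_ofReal (gaussianShift_nonneg a x), gaussianShift, Complex.real_smul,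
      Complex.ofReal_exp, ← Complex.exp_add, ← Complex.exp_add]
    congr 1
    simp only [PiLp.inner_apply, add_mul, Finset.sum_add_distrib]
    push_cast
    simp only [Finset.sum_mul, RCLike.inner_apply, conj_trivial]
    push_cast
    have : ∀ i, (t i : ℂ) * x i * Complex.I = t i * Complex.I * x i := fun i => by ring
    simp only [this, mul_comm (x.ofLp _ : ℂ) (a.ofLp _ : ℂ)]
    ring
  simp only [h1, integral_const_mul, integral_cexp_stdGaussian]
  rw [← Complex.exp_add, ← Complex.exp_add]
  congr 1
  rw [EuclideanSpace.real_norm_sq_eq]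
  have h2 : (‖t‖ : ℂ) ^ 2 = ((∑ i, t i ^ 2 : ℝ) : ℂ) := by
    rw [← EuclideanSpace.real_norm_sq_eq]; push_cast; rfl
  rw [h2, PiLp.inner_apply]
  push_cast
  simp only [RCLike.inner_apply, conj_trivial, Complex.ofReal_mul, ← Finset.sum_div, Finset.sum_mul]
  have h3 : ∀ i, ((a i : ℂ) + t i * Complex.I) ^ 2
      = a i ^ 2 - t i ^ 2 + 2 * (t i * a i * Complex.I) := fun i => by
    linear_combination (t i : ℂ) ^ 2 * Complex.I_sq
  simp only [h3, Finset.sum_add_distrib, Finset.sum_sub_distrib, ← Finset.mul_sum]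
  ring

/-- The Chapman–Robbins inequality for the standard Gaussian location family. -/
theorem sq_integral_sub_le_stdGaussian (a : EuclideanSpace ℝ ι) (f : EuclideanSpace ℝ ι → ℝ)
    (m : ℝ) (hf : Measurable f)
    (hf2 : MemLp (fun x => f x - m) 2 (stdGaussian (EuclideanSpace ℝ ι))) :
    (∫ x, f (a + x) ∂stdGaussian (EuclideanSpace ℝ ι)
        - ∫ x, f x ∂stdGaussian (EuclideanSpace ℝ ι)) ^ 2
      ≤ (∫ x, (f x - m) ^ 2 ∂stdGaussian (EuclideanSpace ℝ ι)) * (Real.exp (‖a‖ ^ 2) - 1) := by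
  set γ := stdGaussian (EuclideanSpace ℝ ι)
  have hL2 : MemLp (gaussianShift a) 2 γ :=
    (memLp_two_iff_integrable_sq (continuous_gaussianShift a).aestronglyMeasurable).2
      (integrable_gaussianShift_sq a)
  have hL1 : MemLp (fun x => gaussianShift a x - 1) 2 γ := hL2.sub (memLp_const 1)
  have hshift : ∫ x, f (a + x) ∂γ = ∫ x, gaussianShift a x * f x ∂γ := by
    have h := integral_map (μ := γ) (φ := fun x => a + x) (f := f) (by fun_prop)
      hf.aestronglyMeasurable
    rw [← h, map_const_add_stdGaussian, integral_withDensity_eq_integral_toReal_smul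
      (continuous_gaussianShift a).measurable.ennreal_ofReal (by simp)]
    simp [ENNReal.toReal_ofReal (gaussianShift_nonneg a _), γ]
  have hfi : Integrable f γ := by
    have := (hf2.integrable (by norm_num)).add (integrable_const m)
    exact this.congr (ae_of_all _ fun x => by simp)
  have hprod := hL1.integrable_mul hf2
  -- The change of mean is the covariance of `f` with the likelihood ratio. Subtracting `m` costs
  -- nothing because the ratio minus one has mean zero.
  have hkey : ∫ x, f (a + x) ∂γ - ∫ x, f x ∂γ
      = ∫ x, (gaussianShift a x - 1) * (f x - m) ∂γ := by
    have e : (fun x => gaussianShift a x * f x)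
        = fun x => ((gaussianShift a x - 1) * (f x - m) + f x)
          + (gaussianShift a x * m - m) := by funext x; ring
    have i1 : Integrable (fun x => gaussianShift a x * m) γ :=
      (integrable_gaussianShift a).mul_const m
    rw [hshift, e, integral_add, integral_add, integral_sub, integral_mul_const,
      integral_gaussianShift]
    · simp
    · exact i1
    · exact integrable_const _
    · exact hprod
    · exact hfi
    · exact hprod.add hfi
    · exact i1.sub (integrable_const _)
  -- The chi-square divergence between the shifted and the unshifted Gaussian.
  have hvar : ∫ x, (gaussianShift a x - 1) ^ 2 ∂γ = Real.exp (‖a‖ ^ 2) - 1 := by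
    have e : (fun x => (gaussianShift a x - 1) ^ 2)
        = fun x => gaussianShift a x ^ 2 - 2 * gaussianShift a x + 1 := by funext x; ring
    rw [e, integral_add, integral_sub, integral_const_mul, integral_gaussianShift,
      integral_gaussianShift_sq]
    · simp; ring
    · exact integrable_gaussianShift_sq a
    · exact (integrable_gaussianShift a).const_mul _
    · exact (integrable_gaussianShift_sq a).sub ((integrable_gaussianShift a).const_mul _)
    · exact integrable_const _
  rw [hkey, ← hvar, mul_comm]
  exact sq_integral_mul_le hL1 hf2

open scoped MatrixOrder in
/-- The Chapman–Robbins inequality for the Gaussian location family with precision matrix `F`. -/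
theorem sq_integral_sub_le_multivariateGaussian [DecidableEq ι] {F : Matrix ι ι ℝ}
    (hF : F.PosDef) (μ δ : EuclideanSpace ℝ ι) (f : EuclideanSpace ℝ ι → ℝ)
    (m : ℝ) (hf : Measurable f)
    (hf2 : MemLp (fun x => f x - m) 2 (multivariateGaussian μ F⁻¹)) :
    (∫ x, f x ∂multivariateGaussian (μ + δ) F⁻¹ - ∫ x, f x ∂multivariateGaussian μ F⁻¹) ^ 2
      ≤ (∫ x, (f x - m) ^ 2 ∂multivariateGaussian μ F⁻¹)
        * (Real.exp (δ.ofLp ⬝ᵥ F *ᵥ δ.ofLp) - 1) := by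
  set A := Matrix.toEuclideanCLM (𝕜 := ℝ) (CFC.sqrt F⁻¹) with hA
  have hAA : ∀ x, A (A x) = Matrix.toEuclideanCLM (𝕜 := ℝ) F⁻¹ x := fun x => by
    rw [← ContinuousLinearMap.comp_apply, ← ContinuousLinearMap.mul_def, hA, ← map_mul,
      CFC.sqrt_mul_sqrt_self _ hF.inv.posSemidef.nonneg]
  have hAsymm : ∀ x y, ⟪A x, y⟫ = ⟪x, A y⟫ := fun x y => by
    have h : IsSelfAdjoint A := (CFC.sqrt_nonneg F⁻¹).isSelfAdjoint.map _
    rw [← ContinuousLinearMap.adjoint_inner_left, h.adjoint_eq]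
  have hdet : IsUnit F.det := (Matrix.isUnit_iff_isUnit_det _).1 hF.isUnit
  -- With `A` the square root of `F⁻¹`, the vector `b = F δ` satisfies `A (A b) = δ`. Shifting the
  -- mean by `δ` is thus a shift by `A b` in standard coordinates, and `‖A b‖² = δᵀ F δ`.
  set b : EuclideanSpace ℝ ι := WithLp.toLp 2 (F *ᵥ δ.ofLp) with hb
  have hFb : Matrix.toEuclideanCLM (𝕜 := ℝ) F⁻¹ b = δ := by
    apply WithLp.ofLp_injective
    rw [Matrix.ofLp_toEuclideanCLM, hb, Matrix.mulVec_mulVec, Matrix.nonsing_inv_mul _ hdet,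
      Matrix.one_mulVec]
  have hnorm : ‖A b‖ ^ 2 = δ.ofLp ⬝ᵥ F *ᵥ δ.ofLp := by
    rw [← real_inner_self_eq_norm_sq, hAsymm, hAA, hFb, hb, EuclideanSpace.inner_eq_star_dotProduct]
    simp
  have hshift : ∀ x, μ + δ + A x = μ + A (A b + x) := fun x => by
    rw [map_add, hAA, hFb, add_assoc]
  have hmeas : ∀ ν : EuclideanSpace ℝ ι, Measurable fun x => ν + A x := fun ν => by fun_prop
  have key := sq_integral_sub_le_stdGaussian (A b) (fun x => f (μ + A x)) m
    (hf.comp (hmeas μ))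
    (hf2.comp_measurePreserving ⟨hmeas μ, rfl⟩)
  rw [hnorm] at key
  simp only [multivariateGaussian]
  rw [integral_map (hmeas _).aemeasurable hf.aestronglyMeasurable,
    integral_map (hmeas _).aemeasurable hf.aestronglyMeasurable,
    integral_map (hmeas _).aemeasurable (by fun_prop)]
  simp only [hshift]
  exact key

end Gaussian

/-- A quadratic rate in a Chapman–Robbins inequality passes to the limit. -/
theorem sq_le_mul_of_sq_le_mul_exp_sub_one {V q c : ℝ} {h : ℝ → ℝ}
    (hc : HasDerivAt h c 0) (h0 : h 0 = 0)
    (hV : ∀ᶠ t in 𝓝[>] (0 : ℝ), h t ^ 2 ≤ V * (Real.exp (t ^ 2 * q) - 1)) :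
    c ^ 2 ≤ V * q := by
  -- Both sides are divided by `t²`: the left becomes a squared slope of `h`, the right a slope of
  -- the exponential in the variable `t²`.
  have h1 : Tendsto (fun t => (t⁻¹ * h t) ^ 2) (𝓝[>] (0 : ℝ)) (𝓝 (c ^ 2)) := by
    have := hc.tendsto_slope_zero_right
    simp only [zero_add, h0, sub_zero, smul_eq_mul] at this
    exact this.pow 2
  have h2 : HasDerivAt (fun u : ℝ => Real.exp (u * q)) q 0 := by
    simpa using ((hasDerivAt_id (0 : ℝ)).mul_const q).exp
  have hsq : Tendsto (fun t : ℝ => t ^ 2) (𝓝[>] (0 : ℝ)) (𝓝[>] 0) := by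
    refine tendsto_nhdsWithin_iff.2 ⟨?_, ?_⟩
    · have : Tendsto (fun t : ℝ => t ^ 2) (𝓝 0) (𝓝 (0 ^ 2)) := (continuous_pow 2).tendsto 0
      simp only [ne_eq, OfNat.ofNat_ne_zero, not_false_eq_true, zero_pow] at this
      exact this.mono_left nhdsWithin_le_nhds
    · filter_upwards [self_mem_nhdsWithin] with t ht
      exact pow_pos (Set.mem_Ioi.1 ht) 2
  have h3 : Tendsto (fun t : ℝ => V * ((t ^ 2)⁻¹ * (Real.exp (t ^ 2 * q) - 1)))
      (𝓝[>] (0 : ℝ)) (𝓝 (V * q)) := by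
    have := h2.tendsto_slope_zero_right
    simp only [zero_add, zero_mul, Real.exp_zero, smul_eq_mul] at this
    exact (this.comp hsq).const_mul V
  refine le_of_tendsto_of_tendsto h1 h3 ?_
  filter_upwards [hV, self_mem_nhdsWithin] with t ht ht0
  have hp : 0 < (t ^ 2)⁻¹ := inv_pos.2 (pow_pos ht0 2)
  calc (t⁻¹ * h t) ^ 2 = (t ^ 2)⁻¹ * h t ^ 2 := by rw [mul_pow, inv_pow]
    _ ≤ (t ^ 2)⁻¹ * (V * (Real.exp (t ^ 2 * q) - 1)) := by gcongr
    _ = _ := by ring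

/-! ### Recovering locations from delays and angles -/

section Geometry

open scoped RealInnerProductSpace

/-- The unit vector in direction `θ`. -/
noncomputable def dir (θ : ℝ) : Plane := !₂[Real.cos θ, Real.sin θ]

@[simp] theorem dir_zero_apply (θ : ℝ) : dir θ 0 = Real.cos θ := rfl

@[simp] theorem dir_one_apply (θ : ℝ) : dir θ 1 = Real.sin θ := rfl

theorem Plane.norm_sq (v : Plane) : ‖v‖ ^ 2 = v 0 ^ 2 + v 1 ^ 2 := by
  rw [EuclideanSpace.real_norm_sq_eq, Fin.sum_univ_two]

theorem Plane.inner_eq (v w : Plane) : ⟪v, w⟫ = v 0 * w 0 + v 1 * w 1 := by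
  rw [PiLp.inner_apply, Fin.sum_univ_two]
  simp [mul_comm]

theorem norm_dir (θ : ℝ) : ‖dir θ‖ = 1 := by
  rw [← sq_eq_sq₀ (norm_nonneg _) zero_le_one, Plane.norm_sq]
  simp

theorem continuous_dir : Continuous dir := by
  unfold dir
  refine (PiLp.continuous_toLp 2 _).comp (continuous_pi fun i => ?_)
  fin_cases i
  · exact Real.continuous_cos
  · exact Real.continuous_sin

/-- The displacement to a point in front is its distance times its direction. -/
theorem sub_eq_norm_smul_dir {p v : Plane} (h : p 0 < v 0) :
    v - p = ‖v - p‖ • dir (Real.arctan ((v 1 - p 1) / (v 0 - p 0))) := by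
  set a := v 0 - p 0 with ha
  set b := v 1 - p 1 with hb
  have ha0 : 0 < a := sub_pos.2 h
  have hn : ‖v - p‖ = a * √(1 + (b / a) ^ 2) := by
    rw [← sq_eq_sq₀ (norm_nonneg _) (by positivity), Plane.norm_sq, mul_pow,
      Real.sq_sqrt (by positivity)]
    simp only [PiLp.sub_apply, ← ha, ← hb]
    field_simp
  have hs : √(1 + (b / a) ^ 2) ≠ 0 := (Real.sqrt_pos.2 (by positivity)).ne'
  rw [hn]
  ext i
  fin_cases i
  · simp only [PiLp.sub_apply, PiLp.smul_apply, smul_eq_mul, Fin.zero_eta, dir_zero_apply,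
      Real.cos_arctan, ← ha]
    field_simp
  · simp only [PiLp.sub_apply, PiLp.smul_apply, smul_eq_mul, Fin.mk_one, dir_one_apply,
      Real.sin_arctan, ← hb]
    field_simp

theorem arctan_smul_dir {r θ : ℝ} (hr : r ≠ 0) (hθ : θ ∈ Set.Ioo (-(Real.pi / 2)) (Real.pi / 2)) :
    Real.arctan ((r • dir θ) 1 / (r • dir θ) 0) = θ := by
  simp only [PiLp.smul_apply, smul_eq_mul, dir_zero_apply, dir_one_apply]
  rw [mul_div_mul_left _ _ hr, ← Real.tan_eq_sin_div_cos, Real.arctan_tan hθ.1 hθ.2]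

/-- The point in direction `θ` from `p` through which the way from `p` to `z` has length `L`. -/
noncomputable def scatterer (z p : Plane) (L θ : ℝ) : Plane :=
  p + ((L ^ 2 - ‖z - p‖ ^ 2) / (2 * (L - ⟪z - p, dir θ⟫))) • dir θ

theorem inner_dir_lt {q : Plane} {L : ℝ} (h : ‖q‖ < L) (θ : ℝ) : ⟪q, dir θ⟫ < L := by
  have := real_inner_le_norm q (dir θ)
  rw [norm_dir, mul_one] at this
  linarith

theorem scatterer_radius_pos {z p : Plane} {L : ℝ} (h : ‖z - p‖ < L) (θ : ℝ) :
    0 < (L ^ 2 - ‖z - p‖ ^ 2) / (2 * (L - ⟪z - p, dir θ⟫)) := by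
  have h1 := inner_dir_lt h θ
  have h2 := norm_nonneg (z - p)
  apply div_pos <;> nlinarith

theorem norm_sub_smul_dir_sq (q : Plane) (r θ : ℝ) :
    ‖q - r • dir θ‖ ^ 2 = ‖q‖ ^ 2 - 2 * (r * ⟪q, dir θ⟫) + r ^ 2 := by
  rw [norm_sub_sq_real, real_inner_smul_right, norm_smul, norm_dir, mul_one, Real.norm_eq_abs,
    sq_abs]

/-- With `q = z - p`, the radius solves `(L - r)² = ‖q‖² - 2 r ⟪q, dir θ⟫ + r²`, which is linear in
`r`. Undoing the square needs `r ≤ L`. -/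
theorem scatterer_length {z p : Plane} {L : ℝ} (h : ‖z - p‖ < L) (θ : ℝ) :
    ‖z - scatterer z p L θ‖ + ‖p - scatterer z p L θ‖ = L := by
  have h1 := inner_dir_lt h θ
  have hr := scatterer_radius_pos h θ
  have h2 := abs_real_inner_le_norm (z - p) (dir θ)
  rw [norm_dir, mul_one] at h2
  have h3 : ⟪z - p, dir θ⟫ ^ 2 ≤ ‖z - p‖ ^ 2 := sq_le_sq' (abs_le.1 h2).1 (abs_le.1 h2).2
  unfold scatterer
  set i := ⟪z - p, dir θ⟫
  set r := (L ^ 2 - ‖z - p‖ ^ 2) / (2 * (L - i)) with hrdef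
  have hr2 : r * (2 * (L - i)) = L ^ 2 - ‖z - p‖ ^ 2 := by
    rw [hrdef]; exact div_mul_cancel₀ _ (by linarith)
  -- Since `i² ≤ ‖z - p‖²`, the equation for `r` gives `2 r ≤ L + i < 2 L`.
  have hLr : 0 ≤ L - r := by
    by_contra hc
    push Not at hc
    nlinarith [sq_nonneg (L - i)]
  have e1 : ‖p - (p + r • dir θ)‖ = r := by
    rw [sub_add_cancel_left, norm_neg, norm_smul, norm_dir, mul_one, Real.norm_eq_abs,
      abs_of_pos hr]
  have e2 : ‖z - (p + r • dir θ)‖ = L - r := by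
    rw [← sq_eq_sq₀ (norm_nonneg _) hLr, ← sub_sub, norm_sub_smul_dir_sq]
    linarith
  rw [e1, e2]
  ring

theorem eq_scatterer {z p v : Plane} (hv : p 0 < v 0) (h : ‖z - p‖ < ‖z - v‖ + ‖p - v‖) :
    v = scatterer z p (‖z - v‖ + ‖p - v‖) (Real.arctan ((v 1 - p 1) / (v 0 - p 0))) := by
  have hd := sub_eq_norm_smul_dir hv
  have h1 := inner_dir_lt h (Real.arctan ((v 1 - p 1) / (v 0 - p 0)))
  set θ := Real.arctan ((v 1 - p 1) / (v 0 - p 0))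
  rw [norm_sub_rev p v] at h h1 ⊢
  set r := ‖v - p‖
  set L := ‖z - v‖ + r with hL
  have hv' : v = p + r • dir θ := by rw [← hd]; abel
  have h2 : (L - r) ^ 2 = ‖z - p‖ ^ 2 - 2 * (r * ⟪z - p, dir θ⟫) + r ^ 2 := by
    rw [← norm_sub_smul_dir_sq, ← hd, hL, add_sub_cancel_right]
    congr 2
    abel
  unfold scatterer
  rw [show (L ^ 2 - ‖z - p‖ ^ 2) / (2 * (L - ⟪z - p, dir θ⟫)) = r by
    rw [div_eq_iff (by linarith)]; linarith]
  exact hv'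

theorem tendsto_scatterer (z : Plane) {α : Type*} {l : Filter α} {p : α → Plane} {L θ : α → ℝ}
    {p₀ : Plane} {L₀ θ₀ : ℝ} (hp : Tendsto p l (𝓝 p₀)) (hL : Tendsto L l (𝓝 L₀))
    (hθ : Tendsto θ l (𝓝 θ₀)) (h : ‖z - p₀‖ < L₀) :
    Tendsto (fun x => scatterer z (p x) (L x) (θ x)) l (𝓝 (scatterer z p₀ L₀ θ₀)) := by
  have hd : Tendsto (fun x => dir (θ x)) l (𝓝 (dir θ₀)) := (continuous_dir.tendsto θ₀).comp hθ
  have hq : Tendsto (fun x => z - p x) l (𝓝 (z - p₀)) := hp.const_sub z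
  have h1 := inner_dir_lt h θ₀
  refine hp.add (Tendsto.smul (Tendsto.div ((hL.pow 2).sub (hq.norm.pow 2))
    ((hL.sub (hq.inner hd)).const_mul 2) ?_) hd)
  linarith

namespace Model

variable {K : ℕ} (M : Model K)

@[simp] theorem node_zero (φ : Locations K) : M.node φ 0 = M.z := rfl

theorem node_of_ne (φ : Locations K) {k : Fin (K + 1)} (hk : k ≠ 0) : M.node φ k = φ k :=
  if_neg hk

theorem toa_zero (φ : Locations K) : M.toa φ 0 = ‖M.z - φ 0‖ / M.c := by
  rw [toa, node_zero, sub_self, norm_zero, zero_add, norm_sub_rev]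

theorem toa_of_ne (φ : Locations K) {k : Fin (K + 1)} (hk : k ≠ 0) :
    M.toa φ k = (‖M.z - φ k‖ + ‖φ 0 - φ k‖) / M.c := by
  rw [toa, node_zero, node_of_ne M φ hk]

theorem c_mul_toa_zero (φ : Locations K) : M.c * M.toa φ 0 = ‖M.z - φ 0‖ := by
  rw [toa_zero, mul_div_cancel₀ _ M.c_pos.ne']

theorem c_mul_toa_of_ne (φ : Locations K) {k : Fin (K + 1)} (hk : k ≠ 0) :
    M.c * M.toa φ k = ‖M.z - φ k‖ + ‖φ 0 - φ k‖ := by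
  rw [toa_of_ne M φ hk, mul_div_cancel₀ _ M.c_pos.ne']

theorem toa_zero_le (φ : Locations K) (k : Fin (K + 1)) : M.toa φ 0 ≤ M.toa φ k := by
  rcases eq_or_ne k 0 with rfl | hk
  · rfl
  · rw [toa_zero, toa_of_ne M φ hk]
    have := M.c_pos
    gcongr
    rw [norm_sub_rev (φ 0)]
    exact norm_sub_le_norm_sub_add_norm_sub _ _ _

theorem toa_zero_pos {φ : Locations K} (h : M.InFront φ) : 0 < M.toa φ 0 := by
  rw [toa_zero]
  refine div_pos (norm_pos_iff.2 fun h0 => ?_) M.c_pos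
  have := h 0
  rw [node_zero, sub_eq_zero.1 h0] at this
  exact lt_irrefl _ this

theorem aod_mem (φ : Locations K) (k : Fin (K + 1)) :
    M.aod φ k ∈ Set.Ioo (-(Real.pi / 2)) (Real.pi / 2) :=
  ⟨Real.neg_pi_div_two_lt_arctan _, Real.arctan_lt_pi_div_two _⟩

/-- The locations with delays `T` and angles `Θ`. -/
noncomputable def locate (T Θ : Fin (K + 1) → ℝ) : Locations K := fun k =>
  if k = 0 then M.z - (M.c * T 0) • dir (Θ 0)
  else scatterer M.z (M.z - (M.c * T 0) • dir (Θ 0)) (M.c * T k) (Θ k)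

theorem locate_zero (T Θ : Fin (K + 1) → ℝ) :
    M.locate T Θ 0 = M.z - (M.c * T 0) • dir (Θ 0) := if_pos rfl

theorem locate_of_ne (T Θ : Fin (K + 1) → ℝ) {k : Fin (K + 1)} (hk : k ≠ 0) :
    M.locate T Θ k = scatterer M.z (M.locate T Θ 0) (M.c * T k) (Θ k) := by
  rw [locate_zero]; exact if_neg hk

theorem norm_z_sub_locate_zero {T : Fin (K + 1) → ℝ} (h0 : 0 < T 0) (Θ : Fin (K + 1) → ℝ) :
    ‖M.z - M.locate T Θ 0‖ = M.c * T 0 := by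
  rw [locate_zero, sub_sub_cancel, norm_smul, norm_dir, mul_one, Real.norm_eq_abs,
    abs_of_pos (mul_pos M.c_pos h0)]

/-- A node with prescribed direction is in front and is seen in this direction. -/
theorem front_of_sub_eq {p v : Plane} {r θ : ℝ} (hr : 0 < r)
    (hθ : θ ∈ Set.Ioo (-(Real.pi / 2)) (Real.pi / 2)) (h : v - p = r • dir θ) :
    p 0 < v 0 ∧ Real.arctan ((v 1 - p 1) / (v 0 - p 0)) = θ := by
  have h0 : v 0 - p 0 = (r • dir θ) 0 := by rw [← h]; rfl
  have h1 : v 1 - p 1 = (r • dir θ) 1 := by rw [← h]; rfl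
  refine ⟨?_, by rw [h0, h1]; exact arctan_smul_dir hr.ne' hθ⟩
  have hc : 0 < (r • dir θ) 0 := mul_pos hr (Real.cos_pos_of_mem_Ioo hθ)
  linarith

/-- The strict inequality `T 0 < T k` makes the locus of total length `c T k` a nondegenerate
ellipse with foci Eve and Alice; the ray from Alice in direction `Θ k` meets it at a positive
distance. -/
theorem locate_spec {T Θ : Fin (K + 1) → ℝ} (h0 : 0 < T 0) (hT : ∀ k, k ≠ 0 → T 0 < T k)
    (hΘ : ∀ k, Θ k ∈ Set.Ioo (-(Real.pi / 2)) (Real.pi / 2)) :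
    M.InFront (M.locate T Θ) ∧ M.toa (M.locate T Θ) = T ∧ M.aod (M.locate T Θ) = Θ := by
  have hc := M.c_pos
  have key : ∀ k, M.locate T Θ 0 0 < M.node (M.locate T Θ) k 0 ∧ M.aod (M.locate T Θ) k = Θ k := by
    intro k
    rcases eq_or_ne k 0 with rfl | hk
    · refine front_of_sub_eq (mul_pos hc h0) (hΘ 0) ?_
      rw [node_zero, locate_zero, sub_sub_cancel]
    · have hlt : ‖M.z - M.locate T Θ 0‖ < M.c * T k := by
        rw [norm_z_sub_locate_zero M h0]
        exact mul_lt_mul_of_pos_left (hT k hk) hc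
      refine front_of_sub_eq (scatterer_radius_pos hlt (Θ k)) (hΘ k) ?_
      rw [node_of_ne M _ hk, locate_of_ne M T Θ hk, scatterer, add_sub_cancel_left]
  refine ⟨fun k => (key k).1, funext fun k => ?_, funext fun k => (key k).2⟩
  apply mul_left_cancel₀ hc.ne'
  rcases eq_or_ne k 0 with rfl | hk
  · rw [c_mul_toa_zero, norm_z_sub_locate_zero M h0]
  · rw [c_mul_toa_of_ne M _ hk, locate_of_ne M T Θ hk, scatterer_length]
    rw [norm_z_sub_locate_zero M h0]
    exact mul_lt_mul_of_pos_left (hT k hk) hc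

theorem locate_toa_aod_zero {φ : Locations K} (h : M.InFront φ) :
    M.locate (M.toa φ) (M.aod φ) 0 = φ 0 := by
  have := sub_eq_norm_smul_dir (h 0)
  rw [node_zero] at this
  rw [locate_zero, c_mul_toa_zero, aod, node_zero, ← this, sub_sub_cancel]

theorem scatterer_toa_aod {φ : Locations K} (h : M.InFront φ) {k : Fin (K + 1)} (hk : k ≠ 0)
    (hlt : M.toa φ 0 < M.toa φ k) :
    scatterer M.z (φ 0) (M.c * M.toa φ k) (M.aod φ k) = φ k := by
  have h1 := h k
  rw [node_of_ne M _ hk] at h1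
  rw [c_mul_toa_of_ne M _ hk, aod, node_of_ne M _ hk]
  refine (eq_scatterer h1 ?_).symm
  rw [← c_mul_toa_zero, ← c_mul_toa_of_ne M _ hk]
  exact mul_lt_mul_of_pos_left hlt M.c_pos

/-- Strictness of the delays is essential: a scatterer on the segment from Alice to Eve has the
line-of-sight delay and angle wherever it lies there. -/
theorem locate_toa_aod {φ : Locations K} (h : M.InFront φ)
    (hlt : ∀ k, k ≠ 0 → M.toa φ 0 < M.toa φ k) :
    M.locate (M.toa φ) (M.aod φ) = φ := by
  funext k
  rcases eq_or_ne k 0 with rfl | hk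
  · exact locate_toa_aod_zero M h
  · rw [locate_of_ne M _ _ hk, locate_toa_aod_zero M h, scatterer_toa_aod M h hk (hlt k hk)]

theorem tendsto_locate {α : Type*} {l : Filter α} {T Θ : α → Fin (K + 1) → ℝ}
    {T₀ Θ₀ : Fin (K + 1) → ℝ} (hT : ∀ k, Tendsto (fun x => T x k) l (𝓝 (T₀ k)))
    (hΘ : ∀ k, Tendsto (fun x => Θ x k) l (𝓝 (Θ₀ k))) (h0 : 0 < T₀ 0)
    (hlt : ∀ k, k ≠ 0 → T₀ 0 < T₀ k) :
    Tendsto (fun x => M.locate (T x) (Θ x)) l (𝓝 (M.locate T₀ Θ₀)) := by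
  have hz : Tendsto (fun x => M.locate (T x) (Θ x) 0) l (𝓝 (M.locate T₀ Θ₀ 0)) :=
    (((hT 0).const_mul M.c).smul ((continuous_dir.tendsto _).comp (hΘ 0))).const_sub M.z
  refine tendsto_pi_nhds.2 fun k => ?_
  rcases eq_or_ne k 0 with rfl | hk
  · exact hz
  · simp only [locate_of_ne M _ _ hk]
    refine tendsto_scatterer M.z hz ((hT k).const_mul M.c) (hΘ k) ?_
    rw [norm_z_sub_locate_zero M h0]
    exact mul_lt_mul_of_pos_left (hlt k hk) M.c_pos

/-- Around non-degenerate locations, the delay and the angle of one path can be varied while those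
of the other paths are kept. -/
theorem exists_path_variation {φ : Locations K} (h : M.InFront φ) (k : Fin (K + 1))
    (hlt : ∀ j, j ≠ 0 → k = 0 ∨ j = k → M.toa φ 0 < M.toa φ j) :
    ∃ Φ : ℝ × ℝ → Locations K,
      Tendsto Φ (𝓝 (M.toa φ k, M.aod φ k)) (𝓝 φ) ∧
      ∀ᶠ x in 𝓝 (M.toa φ k, M.aod φ k),
        M.toa (Φ x) = Function.update (M.toa φ) k x.1 ∧
        M.aod (Φ x) = Function.update (M.aod φ) k x.2 := by
  have hΘ : ∀ᶠ x : ℝ × ℝ in 𝓝 (M.toa φ k, M.aod φ k),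
      x.2 ∈ Set.Ioo (-(Real.pi / 2)) (Real.pi / 2) :=
    continuous_snd.continuousAt.eventually (isOpen_Ioo.mem_nhds (M.aod_mem φ k))
  -- Varying path `0` moves Alice, so every scatterer must be relocated and all other paths must be
  -- nondegenerate. Varying another path moves only its own scatterer, and only that path has to be
  -- nondegenerate.
  rcases eq_or_ne k 0 with rfl | hk
  · have hlt' : ∀ j, j ≠ 0 → M.toa φ 0 < M.toa φ j := fun j hj => hlt j hj (.inl rfl)
    refine ⟨fun x => M.locate (Function.update (M.toa φ) 0 x.1) (Function.update (M.aod φ) 0 x.2),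
      ?_, ?_⟩
    · have h1 : ∀ (f : Fin (K + 1) → ℝ) (g : ℝ × ℝ → ℝ) (x₀ : ℝ × ℝ), ContinuousAt g x₀ →
          g x₀ = f 0 → ∀ k, Tendsto (fun x => Function.update f 0 (g x) k) (𝓝 x₀) (𝓝 (f k)) := by
        intro f g x₀ hg hx k
        rcases eq_or_ne k 0 with rfl | hk
        · simpa only [Function.update_self, ← hx] using hg.tendsto
        · simpa only [Function.update_of_ne hk] using tendsto_const_nhds
      have h2 := M.tendsto_locate (h1 (M.toa φ) Prod.fst (M.toa φ 0, M.aod φ 0)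
        continuousAt_fst rfl) (h1 (M.aod φ) Prod.snd _ continuousAt_snd rfl)
        (M.toa_zero_pos h) hlt'
      rwa [locate_toa_aod M h hlt'] at h2
    · have e1 : ∀ᶠ x : ℝ × ℝ in 𝓝 (M.toa φ 0, M.aod φ 0), 0 < x.1 :=
        continuous_fst.continuousAt.eventually (isOpen_Ioi.mem_nhds (M.toa_zero_pos h))
      have e2 : ∀ᶠ x : ℝ × ℝ in 𝓝 (M.toa φ 0, M.aod φ 0), ∀ j, j ≠ 0 → x.1 < M.toa φ j := by
        refine eventually_all.2 fun j => ?_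
        by_cases hj : j = 0
        · simp [hj]
        · filter_upwards [continuous_fst.continuousAt.eventually
            (isOpen_Iio.mem_nhds (hlt' j hj))] with x hx _ using hx
      filter_upwards [hΘ, e1, e2] with x hx1 hx2 hx3
      refine (M.locate_spec ?_ ?_ ?_).2
      · simpa using hx2
      · intro j hj
        simpa [Function.update_of_ne hj] using hx3 j hj
      · intro j
        rcases eq_or_ne j 0 with rfl | hj
        · simpa using hx1
        · rw [Function.update_of_ne hj]; exact M.aod_mem φ j
  · have hltk := hlt k hk (.inr rfl)
    have hn : ‖M.z - φ 0‖ < M.c * M.toa φ k := by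
      rw [← c_mul_toa_zero]
      exact mul_lt_mul_of_pos_left hltk M.c_pos
    refine ⟨fun x => Function.update φ k (scatterer M.z (φ 0) (M.c * x.1) x.2), ?_, ?_⟩
    · have h1 : Tendsto (fun x : ℝ × ℝ => scatterer M.z (φ 0) (M.c * x.1) x.2)
          (𝓝 (M.toa φ k, M.aod φ k)) (𝓝 (φ k)) := by
        have := tendsto_scatterer M.z (tendsto_const_nhds (x := φ 0))
          ((continuous_fst.tendsto (M.toa φ k, M.aod φ k)).const_mul M.c)
          (continuous_snd.tendsto (M.toa φ k, M.aod φ k)) hn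
        rwa [scatterer_toa_aod M h hk hltk] at this
      have h2 := (tendsto_const_nhds (x := φ)).update k h1
      rwa [Function.update_eq_self] at h2
    · have e1 : ∀ᶠ x : ℝ × ℝ in 𝓝 (M.toa φ k, M.aod φ k), ‖M.z - φ 0‖ < M.c * x.1 :=
        (by fun_prop : Continuous fun x : ℝ × ℝ => M.c * x.1).continuousAt.eventually
          (isOpen_Ioi.mem_nhds hn)
      filter_upwards [hΘ, e1] with x hx1 hx2
      set v := scatterer M.z (φ 0) (M.c * x.1) x.2 with hv
      have h0 : Function.update φ k v 0 = φ 0 := Function.update_of_ne hk.symm _ _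
      have hnode : ∀ j, j ≠ k → M.node (Function.update φ k v) j = M.node φ j := fun j hj => by
        unfold node
        rw [Function.update_of_ne hj]
      have hnk : M.node (Function.update φ k v) k = v := by
        rw [node_of_ne M _ hk, Function.update_self]
      constructor
      · funext j
        rcases eq_or_ne j k with rfl | hj
        · rw [Function.update_self, toa, hnk, h0, node_zero, hv, scatterer_length hx2,
            mul_div_cancel_left₀ _ M.c_pos.ne']
        · rw [Function.update_of_ne hj, toa, toa, hnode j hj, h0, node_zero, node_zero]
      · funext j
        rcases eq_or_ne j k with rfl | hj
        · rw [Function.update_self, aod, hnk, h0]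
          refine (front_of_sub_eq (scatterer_radius_pos hx2 x.2) hx1 ?_).2
          rw [hv, scatterer, add_sub_cancel_left]
        · rw [Function.update_of_ne hj, aod, aod, hnode j hj, h0]

end Model

end Geometry

/-! ### Wrapping and the shifted parameters -/

theorem wrap_eq_of_mem {a b x y : ℝ} (hy : y ∈ Set.Ioc a b) (m : ℤ) (h : y = x - m * (b - a)) :
    wrap a b x = y := by
  have hab : a < b := hy.1.trans_le hy.2
  obtain ⟨m', hm'⟩ := exists_wrap_eq a b x
  have hw := wrap_mem_Ioc hab x
  have hb : 0 < b - a := sub_pos.2 hab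
  have h1 : (m' - m : ℝ) * (b - a) = y - wrap a b x := by rw [hm', h]; ring
  have h2 : (m' - m : ℝ) < 1 := by
    by_contra hc
    nlinarith [hy.1, hy.2, hw.1, hw.2]
  have h3 : (-1 : ℝ) < m' - m := by
    by_contra hc
    nlinarith [hy.1, hy.2, hw.1, hw.2]
  have h4 : m' = m := by
    have h2' : m' - m < 1 := by exact_mod_cast h2
    have h3' : -1 < m' - m := by exact_mod_cast h3
    lia
  rw [hm', h, h4]

/-- Wrapping commutes with any perturbation that stays in the interval, so small variations of the
true parameters pass unchanged to the shifted ones. -/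
theorem wrap_add_of_mem {a b x d : ℝ} (h : wrap a b x + d ∈ Set.Ioc a b) :
    wrap a b (x + d) = wrap a b x + d := by
  obtain ⟨m, hm⟩ := exists_wrap_eq a b x
  exact wrap_eq_of_mem h m (by rw [hm]; ring)

namespace Model

open scoped RealInnerProductSpace

variable {K : ℕ} (M : Model K)

theorem shiftedToa_pos {N : ℕ} (hN : 0 < N) (φ : Locations K) (k : Fin (K + 1)) :
    0 < M.shiftedToa N φ k :=
  (wrap_mem_Ioc (mul_pos (Nat.cast_pos.2 hN) M.Ts_pos) _).1

theorem sin_shiftedAod (φ : Locations K) (k : Fin (K + 1)) :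
    Real.sin (M.shiftedAod φ k)
      = wrap (-1) 1 (Real.sin (M.aod φ k) + Real.sin M.shiftAngle) := by
  have h := wrap_mem_Ioc (by norm_num : (-1 : ℝ) < 1)
    (Real.sin (M.aod φ k) + Real.sin M.shiftAngle)
  exact Real.sin_arcsin h.1.le h.2

theorem shiftedAod_mem {φ : Locations K} {k : Fin (K + 1)}
    (h : Real.cos (M.shiftedAod φ k) ≠ 0) :
    M.shiftedAod φ k ∈ Set.Ioo (-(Real.pi / 2)) (Real.pi / 2) := by
  have hm := Real.arcsin_mem_Icc (wrap (-1) 1 (Real.sin (M.aod φ k) + Real.sin M.shiftAngle))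
  change M.shiftedAod φ k ∈ _ at hm
  refine ⟨lt_of_le_of_ne hm.1 fun he => h ?_, lt_of_le_of_ne hm.2 fun he => h ?_⟩
  · rw [← he, Real.cos_neg, Real.cos_pi_div_two]
  · rw [he, Real.cos_pi_div_two]

/-! ### Pseudo-true locations -/

/-- The locations that explain the shifted delays and angles when path `k` is taken for the
line-of-sight path. -/
noncomputable def explained (N : ℕ) (χ : Locations K) (k : Fin (K + 1)) : Locations K :=
  M.locate (fun j => M.shiftedToa N χ (Equiv.swap 0 k j))
    (fun j => M.shiftedAod χ (Equiv.swap 0 k j))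

theorem explained_zero (N : ℕ) (χ : Locations K) (k : Fin (K + 1)) :
    M.explained N χ k 0 = M.z - (M.c * M.shiftedToa N χ k) • dir (M.shiftedAod χ k) := by
  rw [explained, locate_zero, Equiv.swap_apply_left]

theorem perceivedMap_eq_trueMap_iff (N : ℕ) (χ ψ : Locations K) (k : Fin (K + 1)) :
    M.perceivedMap k ψ = M.trueMap N χ ↔
      (M.toa ψ = fun j => M.shiftedToa N χ (Equiv.swap 0 k j)) ∧
      (M.aod ψ = fun j => M.shiftedAod χ (Equiv.swap 0 k j)) := by
  unfold perceivedMap trueMap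
  rw [(WithLp.toLp_injective 2).eq_iff, Sum.elim_eq_iff]
  constructor
  · rintro ⟨h1, h2⟩
    constructor
    · funext j
      have := congrFun h1 (Equiv.swap 0 k j)
      simpa using this
    · funext j
      have := congrFun h2 (Equiv.swap 0 k j)
      simpa using this
  · rintro ⟨h1, h2⟩
    simp [h1, h2]

theorem swap_lt_of_isFirstPath {N : ℕ} {χ : Locations K} {k : Fin (K + 1)}
    (hk : M.IsFirstPath N χ k) (j : Fin (K + 1)) (hj : j ≠ 0) :
    M.shiftedToa N χ k < M.shiftedToa N χ (Equiv.swap 0 k j) := by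
  refine hk _ fun h => hj ?_
  rw [Equiv.swap_apply_eq_iff, Equiv.swap_apply_right] at h
  exact h

theorem explained_spec {N : ℕ} (hN : 0 < N) {χ : Locations K} {k : Fin (K + 1)}
    (hk : M.IsFirstPath N χ k)
    (hΘ : ∀ j, M.shiftedAod χ j ∈ Set.Ioo (-(Real.pi / 2)) (Real.pi / 2)) :
    M.InFront (M.explained N χ k) ∧ M.perceivedMap k (M.explained N χ k) = M.trueMap N χ := by
  rw [perceivedMap_eq_trueMap_iff]
  refine M.locate_spec ?_ ?_ fun j => hΘ _
  · rw [Equiv.swap_apply_left]; exact M.shiftedToa_pos hN _ _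
  · intro j hj
    rw [Equiv.swap_apply_left]
    exact M.swap_lt_of_isFirstPath hk j hj

/-- The fit is exact, so the divergence attains its least possible value `0`. -/
theorem isPseudoTrue_explained {N : ℕ} (hN : 0 < N) (S : Matrix (EtaIdx K) (EtaIdx K) ℝ)
    {χ : Locations K} {k : Fin (K + 1)} (hk : M.IsFirstPath N χ k)
    (hΘ : ∀ j, M.shiftedAod χ j ∈ Set.Ioo (-(Real.pi / 2)) (Real.pi / 2)) :
    M.IsPseudoTrue N S χ (M.explained N χ k) := by
  obtain ⟨h1, h2⟩ := M.explained_spec hN hk hΘ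
  refine ⟨k, hk, h1, fun ψ _ => ?_⟩
  have : InformationTheory.klDiv (M.trueLaw N S χ) (M.perceivedLaw k S (M.explained N χ k)) = 0 := by
    rw [perceivedLaw, h2, trueLaw, InformationTheory.klDiv_self]
  simp only [Set.mem_ofPred_eq, this, zero_le]

theorem IsFirstPath.unique {M : Model K} {N : ℕ} {χ : Locations K} {k l : Fin (K + 1)}
    (hk : M.IsFirstPath N χ k) (hl : M.IsFirstPath N χ l) : k = l := by
  by_contra h
  exact lt_asymm (hk l (Ne.symm h)) (hl k h)

/-- Any minimizer has divergence `0`, since `explained` does; hence both laws and therefore their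
means agree. The geometry is then inverted, with strictness of the delays supplied by the uniqueness
of the first path. -/
theorem IsPseudoTrue.eq_explained {M : Model K} {N : ℕ} (hN : 0 < N)
    {S : Matrix (EtaIdx K) (EtaIdx K) ℝ} {χ ψ : Locations K} {k : Fin (K + 1)}
    (h : M.IsPseudoTrue N S χ ψ) (hk : M.IsFirstPath N χ k)
    (hΘ : ∀ j, M.shiftedAod χ j ∈ Set.Ioo (-(Real.pi / 2)) (Real.pi / 2)) :
    ψ = M.explained N χ k := by
  obtain ⟨l, hl, hfront, hmin⟩ := h
  obtain rfl := hk.unique hl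
  obtain ⟨h1, h2⟩ := M.explained_spec hN hk hΘ
  have h0 : InformationTheory.klDiv (M.trueLaw N S χ) (M.perceivedLaw k S ψ) = 0 := by
    have h3 := hmin (a := M.explained N χ k) h1
    simp only [Set.mem_ofPred_eq, perceivedLaw, h2] at h3
    rw [trueLaw, InformationTheory.klDiv_self] at h3
    exact le_antisymm h3 zero_le
  have : IsFiniteMeasure (M.trueLaw N S χ) := by unfold trueLaw; infer_instance
  have : IsFiniteMeasure (M.perceivedLaw k S ψ) := by unfold perceivedLaw; infer_instance
  rw [InformationTheory.klDiv_eq_zero_iff] at h0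
  have h4 : M.perceivedMap k ψ = M.trueMap N χ := by
    rw [← integral_id_multivariateGaussian (μ := M.perceivedMap k ψ) (S := S),
      ← integral_id_multivariateGaussian (μ := M.trueMap N χ) (S := S)]
    change ∫ x, x ∂(M.perceivedLaw k S ψ) = ∫ x, x ∂(M.trueLaw N S χ)
    rw [h0]
  obtain ⟨h5, h6⟩ := (M.perceivedMap_eq_trueMap_iff N χ ψ k).1 h4
  rw [explained, ← h5, ← h6, M.locate_toa_aod hfront]
  intro j hj
  rw [h5]
  simp only [Equiv.swap_apply_left]
  exact M.swap_lt_of_isFirstPath hk j hj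

/-! ### Variation of the first path -/

/-- A path with the same true delay as the line of sight also has the same shifted delay. Uniqueness
of the smallest shifted delay rules this out whenever one of the two is the first path. -/
theorem exists_first_path_variation {N : ℕ} {φ : Locations K} (h : M.InFront φ)
    {k : Fin (K + 1)} (hk : M.IsFirstPath N φ k) :
    ∃ Φ : ℝ × ℝ → Locations K,
      Tendsto Φ (𝓝 (M.toa φ k, M.aod φ k)) (𝓝 φ) ∧
      ∀ᶠ x in 𝓝 (M.toa φ k, M.aod φ k),
        M.toa (Φ x) = Function.update (M.toa φ) k x.1 ∧
        M.aod (Φ x) = Function.update (M.aod φ) k x.2 := by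
  refine M.exists_path_variation h k fun j hj hjk => lt_of_le_of_ne (M.toa_zero_le φ j) fun he => ?_
  have hs : M.shiftedToa N φ 0 = M.shiftedToa N φ j := by rw [shiftedToa, shiftedToa, he]
  rcases hjk with rfl | rfl
  · exact (hk j hj).ne hs
  · exact (hk 0 hj.symm).ne hs.symm

theorem shiftedToa_of_toa_eq_update {N : ℕ} {φ χ : Locations K} {k : Fin (K + 1)} {τ : ℝ}
    (h : M.toa χ = Function.update (M.toa φ) k τ) :
    M.shiftedToa N χ
      = Function.update (M.shiftedToa N φ) k (wrap 0 (N * M.Ts) (τ + M.shiftDelay)) := by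
  funext j
  rw [shiftedToa, h]
  rcases eq_or_ne j k with rfl | hj
  · simp
  · rw [Function.update_of_ne hj, Function.update_of_ne hj, shiftedToa]

theorem shiftedAod_of_aod_eq_update {φ χ : Locations K} {k : Fin (K + 1)} {θ : ℝ}
    (h : M.aod χ = Function.update (M.aod φ) k θ) :
    M.shiftedAod χ = Function.update (M.shiftedAod φ) k
      (Real.arcsin (wrap (-1) 1 (Real.sin θ + Real.sin M.shiftAngle))) := by
  funext j
  rw [shiftedAod, h]
  rcases eq_or_ne j k with rfl | hj
  · simp
  · rw [Function.update_of_ne hj, Function.update_of_ne hj, shiftedAod]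

/-- The shifted delay of the first path can be decreased with all other shifted parameters kept. -/
theorem exists_delay_variation {N : ℕ} (hN : 0 < N) {φ : Locations K} (h : M.InFront φ)
    {k : Fin (K + 1)} (hk : M.IsFirstPath N φ k) :
    ∃ χ : ℝ → Locations K, Tendsto χ (𝓝[>] 0) (𝓝 φ) ∧ ∀ᶠ t in 𝓝[>] 0,
      M.shiftedToa N (χ t) = Function.update (M.shiftedToa N φ) k (M.shiftedToa N φ k - t) ∧
      M.shiftedAod (χ t) = M.shiftedAod φ := by
  obtain ⟨Φ, hΦ, hΦ'⟩ := M.exists_first_path_variation h hk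
  have hg : Tendsto (fun t : ℝ => (M.toa φ k - t, M.aod φ k)) (𝓝[>] 0)
      (𝓝 (M.toa φ k, M.aod φ k)) := by
    have : Tendsto (fun t : ℝ => (M.toa φ k - t, M.aod φ k)) (𝓝 0)
      (𝓝 (M.toa φ k - 0, M.aod φ k)) := Continuous.tendsto (by fun_prop) 0
    rw [sub_zero] at this
    exact this.mono_left nhdsWithin_le_nhds
  have hD := wrap_mem_Ioc (mul_pos (Nat.cast_pos.2 hN) M.Ts_pos) (M.toa φ k + M.shiftDelay)
  refine ⟨fun t => Φ (M.toa φ k - t, M.aod φ k), hΦ.comp hg, ?_⟩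
  filter_upwards [hg.eventually hΦ', self_mem_nhdsWithin,
    nhdsWithin_le_nhds (Iio_mem_nhds hD.1)] with t ht ht0 ht1
  refine ⟨?_, ?_⟩
  · rw [M.shiftedToa_of_toa_eq_update ht.1]
    congr 1
    -- The interval is open at `0` and closed at `N Ts`, so a small decrease never leaves it, even
    -- from the right endpoint.
    rw [sub_add_eq_add_sub, sub_eq_add_neg, wrap_add_of_mem]
    · rfl
    · simp only [Set.mem_Ioi, Set.mem_Iio] at ht0 ht1
      exact ⟨by linarith, by linarith [hD.2]⟩
  · rw [M.shiftedAod_of_aod_eq_update ht.2]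
    exact Function.update_eq_self k (M.shiftedAod φ)

/-- The shifted angle of the first path can be varied with all other shifted parameters kept. -/
theorem exists_angle_variation {N : ℕ} {φ : Locations K} (h : M.InFront φ)
    {k : Fin (K + 1)} (hk : M.IsFirstPath N φ k) (hcos : Real.cos (M.shiftedAod φ k) ≠ 0) :
    ∃ χ : ℝ → Locations K, Tendsto χ (𝓝[>] 0) (𝓝 φ) ∧ ∀ᶠ t in 𝓝[>] 0,
      M.shiftedToa N (χ t) = M.shiftedToa N φ ∧
      M.shiftedAod (χ t) = Function.update (M.shiftedAod φ) k (M.shiftedAod φ k + t) := by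
  obtain ⟨Φ, hΦ, hΦ'⟩ := M.exists_first_path_variation h hk
  set θ' := M.shiftedAod φ k with hθ'
  have hθm := M.shiftedAod_mem hcos
  rw [← hθ'] at hθm
  -- `u t` is the sine the true angle needs for the shifted angle to become `θ' + t`: the shift acts
  -- additively on sines.
  set u : ℝ → ℝ := fun t => Real.sin (M.aod φ k) + (Real.sin (θ' + t) - Real.sin θ') with hu
  have hu0 : Tendsto u (𝓝 0) (𝓝 (Real.sin (M.aod φ k))) := by
    have : Tendsto u (𝓝 0) (𝓝 (u 0)) := Continuous.tendsto (by fun_prop) 0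
    simpa [hu] using this
  have hg : Tendsto (fun t : ℝ => (M.toa φ k, Real.arcsin (u t))) (𝓝 0)
      (𝓝 (M.toa φ k, M.aod φ k)) := by
    have h1 := (Real.continuous_arcsin.tendsto _).comp hu0
    rw [Real.arcsin_sin (M.aod_mem φ k).1.le (M.aod_mem φ k).2.le] at h1
    exact tendsto_const_nhds.prodMk_nhds h1
  have hsin : Real.sin (M.aod φ k) ∈ Set.Ioo (-1 : ℝ) 1 := by
    have hc := Real.cos_pos_of_mem_Ioo (M.aod_mem φ k)
    have := Real.sin_sq_add_cos_sq (M.aod φ k)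
    constructor <;> nlinarith
  have e1 : ∀ᶠ t in 𝓝 0, u t ∈ Set.Ioo (-1 : ℝ) 1 := hu0.eventually (isOpen_Ioo.mem_nhds hsin)
  have e2 : ∀ᶠ t in 𝓝 (0 : ℝ), θ' + t ∈ Set.Ioo (-(Real.pi / 2)) (Real.pi / 2) := by
    refine (Continuous.tendsto (f := fun t : ℝ => θ' + t) (by fun_prop) 0).eventually
      (isOpen_Ioo.mem_nhds ?_)
    rwa [add_zero]
  refine ⟨fun t => Φ (M.toa φ k, Real.arcsin (u t)),
    hΦ.comp (hg.mono_left nhdsWithin_le_nhds), nhdsWithin_le_nhds ?_⟩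
  filter_upwards [hg.eventually hΦ', e1, e2] with t ht ht1 ht2
  refine ⟨?_, ?_⟩
  · rw [M.shiftedToa_of_toa_eq_update ht.1]
    exact Function.update_eq_self k (M.shiftedToa N φ)
  · rw [M.shiftedAod_of_aod_eq_update ht.2]
    congr 1
    have hs : wrap (-1) 1 (Real.sin (M.aod φ k) + Real.sin M.shiftAngle)
        + (Real.sin (θ' + t) - Real.sin θ') = Real.sin (θ' + t) := by
      rw [← sin_shiftedAod, ← hθ']; ring
    rw [Real.sin_arcsin ht1.1.le ht1.2.le, hu]
    simp only
    rw [add_right_comm, wrap_add_of_mem, hs, Real.arcsin_sin ht2.1.le ht2.2.le]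
    -- An angle strictly between `-π/2` and `π/2` has sine strictly inside `(-1, 1)`, so no
    -- wrap-around occurs.
    rw [hs]
    have hc := Real.cos_pos_of_mem_Ioo ht2
    have := Real.sin_sq_add_cos_sq (θ' + t)
    constructor <;> nlinarith

/-! ### The bound -/

/-- One-parameter information inequality for misspecified-unbiased estimators. -/
theorem sq_le_of_variation {N : ℕ} (hN : 0 < N) {F : Matrix (EtaIdx K) (EtaIdx K) ℝ}
    (hF : F.PosDef) {φ : Locations K} {k : Fin (K + 1)}
    (hk : M.IsFirstPath N φ k)
    (hΘ : ∀ j, M.shiftedAod φ j ∈ Set.Ioo (-(Real.pi / 2)) (Real.pi / 2))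
    {e : EuclideanSpace ℝ (EtaIdx K) → Plane} (he : Measurable e)
    (hunb : M.MisspecifiedUnbiased N F⁻¹ φ e)
    (i : EtaIdx K) (ε : ℝ) (hε : ε ^ 2 = 1) {χ : ℝ → Locations K}
    (hχ : Tendsto χ (𝓝[>] 0) (𝓝 φ))
    (hmap : ∀ᶠ t in 𝓝[>] 0,
      M.trueMap N (χ t) = M.trueMap N φ + EuclideanSpace.single i (ε * t))
    (hfirst : ∀ᶠ t in 𝓝[>] 0, M.IsFirstPath N (χ t) k)
    (hangle : ∀ᶠ t in 𝓝[>] 0, ∀ j, M.shiftedAod (χ t) j ∈ Set.Ioo (-(Real.pi / 2)) (Real.pi / 2))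
    (w : Plane) {h : ℝ → ℝ} {c : ℝ} (h0 : h 0 = 0) (hc : HasDerivAt h c 0)
    (hh : ∀ᶠ t in 𝓝[>] 0, ⟪M.explained N (χ t) k 0 - M.explained N φ k 0, w⟫ = h t)
    (hL2 : MemLp (fun x => ⟪e x, w⟫ - ⟪M.explained N φ k 0, w⟫) 2 (M.trueLaw N F⁻¹ φ)) :
    c ^ 2 ≤ (∫ x, (⟪e x, w⟫ - ⟪M.explained N φ k 0, w⟫) ^ 2 ∂(M.trueLaw N F⁻¹ φ)) * F i i := by
  refine sq_le_mul_of_sq_le_mul_exp_sub_one hc h0 ?_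
  -- Unbiasedness is used at `φ` and at the nearby `χ t`; it turns both means in the Chapman–Robbins
  -- inequality into pseudo-true positions. The sign `ε` lets a decreasing parameter be followed by
  -- `t > 0`.
  have hbase := hunb.self_of_nhds _ (M.isPseudoTrue_explained hN F⁻¹ hk hΘ)
  filter_upwards [hmap, hfirst, hangle, hh, hχ.eventually hunb] with t h1 h2 h3 h4 h5
  have h6 := h5 _ (M.isPseudoTrue_explained hN F⁻¹ h2 h3)
  have key := sq_integral_sub_le_multivariateGaussian hF (M.trueMap N φ)
    (EuclideanSpace.single i (ε * t)) (fun x => ⟪e x, w⟫) ⟪M.explained N φ k 0, w⟫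
    (he.inner measurable_const) hL2
  rw [← h1] at key
  have hint : ∀ χ' : Locations K, Integrable e (M.trueLaw N F⁻¹ χ') →
      ∫ x, ⟪e x, w⟫ ∂(M.trueLaw N F⁻¹ χ') = ⟪∫ x, e x ∂(M.trueLaw N F⁻¹ χ'), w⟫ := by
    intro χ' hi
    simp only [real_inner_comm w]
    exact integral_inner hi w
  have e1 : ∫ x, ⟪e x, w⟫ ∂multivariateGaussian (M.trueMap N (χ t)) F⁻¹
      = ⟪M.explained N (χ t) k 0, w⟫ := by rw [← h6.2, ← hint _ h6.1, trueLaw]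
  have e2 : ∫ x, ⟪e x, w⟫ ∂multivariateGaussian (M.trueMap N φ) F⁻¹
      = ⟪M.explained N φ k 0, w⟫ := by rw [← hbase.2, ← hint _ hbase.1, trueLaw]
  have e3 : (EuclideanSpace.single i (ε * t)).ofLp ⬝ᵥ F *ᵥ (EuclideanSpace.single i (ε * t)).ofLp
      = t ^ 2 * F i i := by
    simp only [PiLp.ofLp_single, Matrix.mulVec_single, single_dotProduct]
    simp only [Pi.smul_apply, Matrix.col_apply, MulOpposite.smul_eq_mul_unop, MulOpposite.unop_op]
    linear_combination t ^ 2 * F i i * hε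
  rw [e1, e2, e3, ← inner_sub_left, h4] at key
  exact key

theorem update_lt_of_isFirstPath {N : ℕ} {φ χ : Locations K} {k : Fin (K + 1)}
    (hk : M.IsFirstPath N φ k) {t : ℝ} (ht : 0 ≤ t)
    (h : M.shiftedToa N χ = Function.update (M.shiftedToa N φ) k (M.shiftedToa N φ k - t)) :
    M.IsFirstPath N χ k := fun j hj => by
  rw [h, Function.update_self, Function.update_of_ne hj]
  linarith [hk j hj]

/-- The misspecified Cramér–Rao bound for Alice's position. -/
theorem ofReal_le_mse {N : ℕ} (hN : 0 < N) {F : Matrix (EtaIdx K) (EtaIdx K) ℝ}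
    (hF : F.PosDef) {φ : Locations K} (hfront : M.InFront φ) {k : Fin (K + 1)}
    (hk : M.IsFirstPath N φ k) (hcos : ∀ j, Real.cos (M.shiftedAod φ j) ≠ 0)
    {e : EuclideanSpace ℝ (EtaIdx K) → Plane} (he : Measurable e)
    (hunb : M.MisspecifiedUnbiased N F⁻¹ φ e) :
    ENNReal.ofReal (M.c ^ 2 / F (.inl k) (.inl k)
        + (M.c * M.shiftedToa N φ k) ^ 2 / F (.inr k) (.inr k)
        + ‖M.explained N φ k 0 - φ 0‖ ^ 2) ≤ M.mse N F⁻¹ φ e := by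
  have hΘ := fun j => M.shiftedAod_mem (hcos j)
  set D := M.shiftedToa N φ k with hD
  set θ := M.shiftedAod φ k with hθ
  set m := M.explained N φ k 0 with hm
  set P := M.trueLaw N F⁻¹ φ with hP
  have : IsProbabilityMeasure P := by rw [hP]; unfold trueLaw; infer_instance
  have hbase := hunb.self_of_nhds _ (M.isPseudoTrue_explained hN F⁻¹ hk hΘ)
  rw [← hP] at hbase
  -- An infinite error satisfies the bound trivially; otherwise the estimator is square-integrable.
  by_cases hfin : M.mse N F⁻¹ φ e = ∞
  · rw [hfin]; exact le_top
  have hL2' : MemLp (fun x => e x - φ 0) 2 P := by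
    refine ⟨(he.sub_const _).aestronglyMeasurable, ?_⟩
    rw [eLpNorm_lt_top_iff_lintegral_rpow_enorm_lt_top (by norm_num) (by norm_num)]
    simpa [mse] using lt_top_iff_ne_top.2 hfin
  have hmse : M.mse N F⁻¹ φ e = ENNReal.ofReal (∫ x, ‖e x - φ 0‖ ^ 2 ∂P) := by
    rw [ofReal_integral_eq_lintegral_ofReal hL2'.norm.integrable_sq
      (ae_of_all _ fun x => sq_nonneg _), mse]
    refine lintegral_congr fun x => ?_
    rw [ENNReal.ofReal_pow (norm_nonneg _), ofReal_norm]
  have hL2 : MemLp (fun x => e x - m) 2 P := by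
    have := hL2'.sub (memLp_const (m - φ 0))
    refine this.ae_eq (ae_of_all _ fun x => ?_)
    simp
  have hinner : ∀ w : Plane, MemLp (fun x => ⟪e x, w⟫ - ⟪m, w⟫) 2 P := fun w => by
    have := hL2.inner_const (𝕜 := ℝ) w
    simpa only [inner_sub_left] using this
  -- Radial and tangential unit vectors as seen from Eve: the delay moves the pseudo-true position
  -- along `w₁`, the angle to first order along `w₂`.
  set w₁ := dir θ with hw₁
  set w₂ : Plane := !₂[-Real.sin θ, Real.cos θ] with hw₂
  have hpyth : ∀ v : Plane, ‖v‖ ^ 2 = ⟪v, w₁⟫ ^ 2 + ⟪v, w₂⟫ ^ 2 := fun v => by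
    have h2 : w₂ 0 = -Real.sin θ := rfl
    have h3 : w₂ 1 = Real.cos θ := rfl
    rw [Plane.norm_sq, Plane.inner_eq, Plane.inner_eq, h2, h3, hw₁, dir_zero_apply, dir_one_apply]
    linear_combination (-(v 0 ^ 2) - v 1 ^ 2) * Real.sin_sq_add_cos_sq θ
  set V₁ := ∫ x, (⟪e x, w₁⟫ - ⟪m, w₁⟫) ^ 2 ∂P
  set V₂ := ∫ x, (⟪e x, w₂⟫ - ⟪m, w₂⟫) ^ 2 ∂P
  -- Bias–variance decomposition; the cross term vanishes because the mean of `e` is `m`.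
  have hdecomp : ∫ x, ‖e x - φ 0‖ ^ 2 ∂P = V₁ + V₂ + ‖m - φ 0‖ ^ 2 := by
    have e1 : ∀ x, ‖e x - φ 0‖ ^ 2 = ((⟪e x, w₁⟫ - ⟪m, w₁⟫) ^ 2 + (⟪e x, w₂⟫ - ⟪m, w₂⟫) ^ 2)
        + (2 * ⟪m - φ 0, e x - m⟫ + ‖m - φ 0‖ ^ 2) := fun x => by
      rw [← inner_sub_left, ← inner_sub_left, ← hpyth, ← add_assoc, real_inner_comm,
        ← norm_add_sq_real]
      congr 2
      abel
    have i0 : Integrable (fun x => e x - m) P := hL2.integrable (by norm_num)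
    have i1 : Integrable (fun x => 2 * ⟪m - φ 0, e x - m⟫) P :=
      (i0.const_inner (𝕜 := ℝ) (m - φ 0)).const_mul 2
    have e2 : ∫ x, ⟪m - φ 0, e x - m⟫ ∂P = 0 := by
      rw [integral_inner i0, integral_sub hbase.1 (integrable_const _), hbase.2]
      simp [hm]
    simp only [e1]
    rw [integral_add, integral_add, integral_add, integral_const_mul, e2]
    · simp [V₁, V₂]
    · exact i1
    · exact integrable_const _
    · exact (hinner w₁).integrable_sq
    · exact (hinner w₂).integrable_sq
    · exact (hinner w₁).integrable_sq.add (hinner w₂).integrable_sq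
    · exact i1.add (integrable_const _)
  -- Shortening the delay by `t` moves the position by `c t` along `w₁`.
  have hb₁ : M.c ^ 2 ≤ V₁ * F (.inl k) (.inl k) := by
    obtain ⟨χ, hχ, hχ'⟩ := M.exists_delay_variation hN hfront hk
    refine M.sq_le_of_variation hN hF hk hΘ he hunb (.inl k) (-1) (by norm_num) hχ ?_ ?_ ?_ w₁
      (h := fun t => M.c * t) (mul_zero _)
      (by simpa using (hasDerivAt_id (0 : ℝ)).const_mul M.c) ?_ (hinner w₁)
    · filter_upwards [hχ'] with t ht
      unfold trueMap
      rw [ht.1, ht.2]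
      ext (j | j)
      · rcases eq_or_ne j k with rfl | hj
        · simp [sub_eq_add_neg]
        · simp [hj]
      · simp
    · filter_upwards [hχ', self_mem_nhdsWithin] with t ht ht0
      exact M.update_lt_of_isFirstPath hk (le_of_lt ht0) ht.1
    · filter_upwards [hχ'] with t ht
      rw [ht.2]; exact hΘ
    · filter_upwards [hχ'] with t ht
      rw [explained_zero, explained_zero, ht.1, ht.2, Function.update_self, ← hθ, ← hD, ← hw₁,
        sub_sub_sub_cancel_left, ← sub_smul, real_inner_smul_left, real_inner_self_eq_norm_sq,
        hw₁, norm_dir]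
      ring
  -- Turning the angle by `t` gives tangential displacement `-c D sin t`, whose derivative at `0` is
  -- `-c D`.
  have hb₂ : (-(M.c * D)) ^ 2 ≤ V₂ * F (.inr k) (.inr k) := by
    obtain ⟨χ, hχ, hχ'⟩ := M.exists_angle_variation hfront hk (hcos k)
    refine M.sq_le_of_variation hN hF hk hΘ he hunb (.inr k) 1 (by norm_num) hχ ?_ ?_ ?_ w₂
      (h := fun t => -(M.c * D) * Real.sin t) (by simp)
      (by simpa using (Real.hasDerivAt_sin 0).const_mul (-(M.c * D))) ?_ (hinner w₂)
    · filter_upwards [hχ'] with t ht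
      unfold trueMap
      rw [ht.1, ht.2]
      ext (j | j)
      · simp
      · rcases eq_or_ne j k with rfl | hj
        · simp
        · simp [hj]
    · filter_upwards [hχ'] with t ht j hj
      rw [ht.1]; exact hk j hj
    · have : ∀ᶠ t in 𝓝 (0 : ℝ), θ + t ∈ Set.Ioo (-(Real.pi / 2)) (Real.pi / 2) := by
        refine (Continuous.tendsto (f := fun t : ℝ => θ + t) (by fun_prop) 0).eventually
          (isOpen_Ioo.mem_nhds ?_)
        rw [add_zero]; exact hΘ k
      filter_upwards [hχ', nhdsWithin_le_nhds this] with t ht ht1 j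
      rw [ht.2]
      rcases eq_or_ne j k with rfl | hj
      · rw [Function.update_self]; exact ht1
      · rw [Function.update_of_ne hj]; exact hΘ j
    · filter_upwards [hχ'] with t ht
      have h2 : w₂ 0 = -Real.sin θ := rfl
      have h3 : w₂ 1 = Real.cos θ := rfl
      rw [explained_zero, explained_zero, ht.1, ht.2, Function.update_self, ← hθ, ← hD,
        sub_sub_sub_cancel_left, ← smul_sub, real_inner_smul_left, Plane.inner_eq, h2, h3]
      simp only [PiLp.sub_apply, dir_zero_apply, dir_one_apply, Real.cos_add, Real.sin_add]
      linear_combination (-(M.c * D) * Real.sin t) * Real.sin_sq_add_cos_sq θ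
  have hF₁ : 0 < F (.inl k) (.inl k) := hF.diag_pos
  have hF₂ : 0 < F (.inr k) (.inr k) := hF.diag_pos
  rw [hmse, hdecomp]
  apply ENNReal.ofReal_le_ofReal
  rw [neg_sq] at hb₂
  have := (div_le_iff₀ hF₁).2 hb₁
  have := (div_le_iff₀ hF₂).2 hb₂
  linarith

end Model

/-! ### Sample covariance of the pilots -/

/-- The averaged outer products of the pilots converge to their expectation `I / Nt`. -/
def PilotsConverge {N Nt : ℕ} (s : ℕ → Fin N → Fin Nt → ℂ) : Prop :=
  ∀ n m m', Tendsto (fun G : ℕ => (G : ℝ)⁻¹ • ∑ g ∈ Finset.range G, s g n m * conj (s g n m'))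
    atTop (𝓝 (if m = m' then 1 / (Nt : ℂ) else 0))

/-- The strong law, entry by entry; products of entries are integrable because the entries are
square-integrable, and there are finitely many of them. -/
theorem IsPilotSequence.ae_pilotsConverge {Ω : Type*} [MeasurableSpace Ω] {P : Measure Ω}
    {N Nt : ℕ} {s : ℕ → Fin N → Ω → Fin Nt → ℂ} (hs : IsPilotSequence P s) :
    ∀ᵐ ω ∂P, PilotsConverge (fun g n => s g n ω) := by
  refine ae_all_iff.2 fun n => ae_all_iff.2 fun m => ae_all_iff.2 fun m' => ?_
  have hmeas : Measurable fun v : Fin Nt → ℂ => v m * conj (v m') :=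
    (measurable_pi_apply m).mul (Complex.continuous_conj.measurable.comp (measurable_pi_apply m'))
  have h := strong_law_ae (μ := P) (fun g ω => s g n ω m * conj (s g n ω m'))
    ((hs.memLp 0 n m).integrable_mul (hs.memLp 0 n m').star)
    (fun i j hij => ((hs.indep n).indepFun hij).comp hmeas hmeas)
    (fun g => (hs.identDistrib g n).comp hmeas)
  rw [hs.secondMoment 0 n m m'] at h
  exact h

section Energy

variable {N Nt : ℕ} {s : ℕ → Fin N → Fin Nt → ℂ}

theorem norm_sum_mul_sq {ι : Type*} [Fintype ι] (v x : ι → ℂ) :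
    ‖∑ m, v m * x m‖ ^ 2 = (∑ m, ∑ m', v m * conj (v m') * (x m * conj (x m'))).re := by
  rw [← Complex.ofReal_re (‖∑ m, v m * x m‖ ^ 2)]
  congr 1
  push_cast
  rw [← Complex.mul_conj', map_sum, Finset.sum_mul_sum]
  refine Finset.sum_congr rfl fun m _ => Finset.sum_congr rfl fun m' _ => ?_
  rw [map_mul]
  ring

theorem average_energy_eq (v : Fin Nt → ℂ) (n : Fin N) (G : ℕ) :
    (G : ℝ)⁻¹ * ∑ g ∈ Finset.range G, ‖∑ m, v m * s g n m‖ ^ 2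
      = (∑ m, ∑ m', v m * conj (v m')
          * ((G : ℝ)⁻¹ • ∑ g ∈ Finset.range G, s g n m * conj (s g n m'))).re := by
  simp only [norm_sum_mul_sq]
  rw [← Complex.re_sum, ← Complex.re_ofReal_mul]
  congr 1
  rw [Finset.mul_sum]
  simp only [Complex.real_smul, Finset.mul_sum]
  rw [Finset.sum_comm]
  refine Finset.sum_congr rfl fun m _ => ?_
  rw [Finset.sum_comm]
  refine Finset.sum_congr rfl fun m' _ => Finset.sum_congr rfl fun g _ => ?_
  ring

theorem sum_ite_mul_conj (v : Fin Nt → ℂ) :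
    (∑ m, ∑ m', v m * conj (v m') * (if m = m' then 1 / (Nt : ℂ) else 0)).re
      = (Nt : ℝ)⁻¹ * ∑ m, ‖v m‖ ^ 2 := by
  rw [← Complex.ofReal_re ((Nt : ℝ)⁻¹ * ∑ m, ‖v m‖ ^ 2)]
  congr 1
  push_cast
  rw [Finset.mul_sum]
  refine Finset.sum_congr rfl fun m _ => ?_
  simp only [mul_ite, mul_zero, Finset.sum_ite_eq, Finset.mem_univ, if_true]
  rw [Complex.mul_conj']
  ring

theorem PilotsConverge.tendsto_energy (hs : PilotsConverge s) (v : Fin Nt → ℂ) (n : Fin N) :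
    Tendsto (fun G : ℕ => (G : ℝ)⁻¹ * ∑ g ∈ Finset.range G, ‖∑ m, v m * s g n m‖ ^ 2) atTop
      (𝓝 ((Nt : ℝ)⁻¹ * ∑ m, ‖v m‖ ^ 2)) := by
  simp only [average_energy_eq]
  rw [← sum_ite_mul_conj]
  exact (Complex.continuous_re.tendsto _).comp (tendsto_finsetSum _ fun m _ =>
    tendsto_finsetSum _ fun m' _ => (hs n m m').const_mul _)

/-- Eventually the sample covariance is bounded below by half of its limit. -/
theorem PilotsConverge.eventually_energy_ge (hs : PilotsConverge s) (hNt : 0 < Nt) :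
    ∀ᶠ G : ℕ in atTop, ∀ (n : Fin N) (v : Fin Nt → ℂ),
      (2 * Nt : ℝ)⁻¹ * ∑ m, ‖v m‖ ^ 2
        ≤ (G : ℝ)⁻¹ * ∑ g ∈ Finset.range G, ‖∑ m, v m * s g n m‖ ^ 2 := by
  have hNt' : (0 : ℝ) < Nt := Nat.cast_pos.2 hNt
  -- With this entrywise tolerance, `(∑ ‖v m‖)² ≤ Nt ∑ ‖v m‖²` bounds the error by half of the limit
  -- `Nt⁻¹ ∑ ‖v m‖²`, uniformly in `v`.
  have hε : (0 : ℝ) < (2 * Nt ^ 2 : ℝ)⁻¹ := by positivity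
  have hev : ∀ᶠ G : ℕ in atTop, ∀ n m m',
      ‖(G : ℝ)⁻¹ • ∑ g ∈ Finset.range G, s g n m * conj (s g n m')
        - (if m = m' then 1 / (Nt : ℂ) else 0)‖ ≤ (2 * Nt ^ 2 : ℝ)⁻¹ := by
    refine eventually_all.2 fun n => eventually_all.2 fun m => eventually_all.2 fun m' => ?_
    filter_upwards [Metric.tendsto_nhds.1 (hs n m m') _ hε] with G hG
    rw [← dist_eq_norm]
    exact hG.le
  filter_upwards [hev] with G hG n v
  rw [average_energy_eq]
  set R : Fin Nt → Fin Nt → ℂ := fun m m' =>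
    (G : ℝ)⁻¹ • ∑ g ∈ Finset.range G, s g n m * conj (s g n m') with hR
  have h1 : (∑ m, ∑ m', v m * conj (v m') * R m m').re = (Nt : ℝ)⁻¹ * ∑ m, ‖v m‖ ^ 2
      + (∑ m, ∑ m', v m * conj (v m') * (R m m' - if m = m' then 1 / (Nt : ℂ) else 0)).re := by
    rw [← sum_ite_mul_conj, ← Complex.add_re]
    simp only [mul_sub, Finset.sum_sub_distrib]
    congr 1
    ring
  have h2 : ‖∑ m, ∑ m', v m * conj (v m') * (R m m' - if m = m' then 1 / (Nt : ℂ) else 0)‖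
      ≤ (2 * Nt : ℝ)⁻¹ * ∑ m, ‖v m‖ ^ 2 := by
    calc _ ≤ ∑ m, ∑ m', ‖v m‖ * ‖v m'‖ * (2 * Nt ^ 2 : ℝ)⁻¹ := by
          refine (norm_sum_le _ _).trans (Finset.sum_le_sum fun m _ =>
            (norm_sum_le _ _).trans (Finset.sum_le_sum fun m' _ => ?_))
          rw [norm_mul, norm_mul, RCLike.norm_conj]
          exact mul_le_mul_of_nonneg_left (hG n m m') (by positivity)
      _ = (∑ m, ‖v m‖) ^ 2 * (2 * Nt ^ 2 : ℝ)⁻¹ := by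
          rw [sq (∑ m, ‖v m‖), Finset.sum_mul_sum, Finset.sum_mul]
          simp only [Finset.sum_mul]
      _ ≤ (Nt * ∑ m, ‖v m‖ ^ 2) * (2 * Nt ^ 2 : ℝ)⁻¹ := by
          gcongr
          simpa using sq_sum_le_card_mul_sum_sq (s := Finset.univ) (f := fun m => ‖v m‖)
      _ = _ := by field_simp
  rw [h1]
  have h3 := (abs_le.1 ((Complex.abs_re_le_norm _).trans h2)).1
  have h4 : (Nt : ℝ)⁻¹ * ∑ m, ‖v m‖ ^ 2 = 2 * ((2 * Nt : ℝ)⁻¹ * ∑ m, ‖v m‖ ^ 2) := by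
    field_simp
  linarith

end Energy

namespace Model

variable {K : ℕ} (M : Model K)

/-! ### Derivatives of the channel -/

/-- The phase of path `k` on sub-carrier `n` and antenna `m`. -/
noncomputable def phase (N Nt : ℕ) (ξ : XiIdx K → ℝ) (k : Fin (K + 1)) (n : Fin N) (m : Fin Nt) :
    ℂ :=
  Complex.exp (-Complex.I * ((2 * Real.pi * (n : ℕ) * ξ (.inl (.inl k)) / (N * M.Ts) : ℝ) : ℂ)) *
    conj (M.steering Nt (ξ (.inl (.inr k))) m)

/-- Angular frequency step between sub-carriers. -/
noncomputable def freqStep (N : ℕ) : ℝ := 2 * Real.pi / (N * M.Ts)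

/-- Derivative of the phase step between antennas with respect to the angle. -/
noncomputable def phaseStep (θ : ℝ) : ℝ := 2 * Real.pi * M.spacing * Real.cos θ / M.wavelength

/-- Partial derivative of the channel, relative to the phase of the path. -/
noncomputable def relDeriv (N Nt : ℕ) (ξ : XiIdx K → ℝ) (n : Fin N) (m : Fin Nt) : XiIdx K → ℂ :=
  Sum.elim
    (Sum.elim
      (fun k => ((ξ (.inr (.inl k)) : ℂ) + (ξ (.inr (.inr k)) : ℂ) * Complex.I) *
        (-Complex.I * ((M.freqStep N * (n : ℕ) : ℝ) : ℂ)))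
      (fun k => ((ξ (.inr (.inl k)) : ℂ) + (ξ (.inr (.inr k)) : ℂ) * Complex.I) *
        (Complex.I * ((M.phaseStep (ξ (.inl (.inr k))) * (m : ℕ) : ℝ) : ℂ))))
    (Sum.elim (fun _ => 1) (fun _ => Complex.I))

theorem conj_steering (Nt : ℕ) (θ : ℝ) (m : Fin Nt) :
    conj (M.steering Nt θ m) = Complex.exp (Complex.I *
      ((2 * Real.pi * (m : ℕ) * M.spacing * Real.sin θ / M.wavelength : ℝ) : ℂ)) := by
  rw [steering, ← Complex.exp_conj, map_mul, Complex.conj_ofReal, map_neg, Complex.conj_I, neg_neg]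

theorem norm_phase (N Nt : ℕ) (ξ : XiIdx K → ℝ) (k : Fin (K + 1)) (n : Fin N) (m : Fin Nt) :
    ‖M.phase N Nt ξ k n m‖ = 1 := by
  rw [phase, conj_steering, norm_mul]
  rw [mul_comm Complex.I, Complex.norm_exp_ofReal_mul_I, neg_mul, mul_comm Complex.I, ← neg_mul,
    ← Complex.ofReal_neg, Complex.norm_exp_ofReal_mul_I]
  simp

theorem channel_eq (N Nt : ℕ) (ξ : XiIdx K → ℝ) (n : Fin N) (m : Fin Nt) :
    M.channel N Nt ξ n m = ∑ k, ((ξ (.inr (.inl k)) : ℂ) + (ξ (.inr (.inr k)) : ℂ) * Complex.I) *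
      M.phase N Nt ξ k n m := by
  simp only [channel, phase, mul_assoc]

theorem hasDerivAt_channel (N Nt : ℕ) (ξ : XiIdx K → ℝ) (n : Fin N) (m : Fin Nt) (i : XiIdx K) :
    HasDerivAt (fun t : ℝ => M.channel N Nt (Function.update ξ i t) n m)
      (M.relDeriv N Nt ξ n m i * M.phase N Nt ξ (pathOf i) n m) (ξ i) := by
  simp only [channel_eq]
  -- Parameter `i` occurs only in the summand of its own path, so the other summands are constant.
  have key : ∀ k, HasDerivAt (fun t : ℝ =>
      ((Function.update ξ i t (.inr (.inl k)) : ℂ)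
        + (Function.update ξ i t (.inr (.inr k)) : ℂ) * Complex.I)
          * M.phase N Nt (Function.update ξ i t) k n m)
      (if pathOf i = k then M.relDeriv N Nt ξ n m i * M.phase N Nt ξ k n m else 0) (ξ i) := by
    intro k
    split_ifs with hk
    · subst hk
      have hid : HasDerivAt (fun t : ℝ => (t : ℂ)) 1 (ξ i) := Complex.ofRealCLM.hasDerivAt
      rcases i with (j | j) | (j | j)
      · have h1 : HasDerivAt (fun t : ℝ => 2 * Real.pi * (n : ℕ) * t / (N * M.Ts))
            (M.freqStep N * (n : ℕ)) (ξ (.inl (.inl j))) := by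
          convert! ((hasDerivAt_id (ξ (.inl (.inl j)))).const_mul
            (2 * Real.pi * (n : ℕ))).div_const (N * M.Ts) using 1
          rw [freqStep]; ring
        have h2 := ((h1.ofReal_comp.const_mul (-Complex.I)).cexp.mul_const
          (conj (M.steering Nt (ξ (.inl (.inr j))) m))).const_mul
            ((ξ (.inr (.inl j)) : ℂ) + (ξ (.inr (.inr j)) : ℂ) * Complex.I)
        convert! h2 using 1
        · funext t; simp [phase, pathOf]
        · simp [phase, pathOf, relDeriv]; ring
      · have h1 : HasDerivAt (fun t : ℝ =>
            2 * Real.pi * (m : ℕ) * M.spacing * Real.sin t / M.wavelength)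
            (M.phaseStep (ξ (.inl (.inr j))) * (m : ℕ)) (ξ (.inl (.inr j))) := by
          convert! ((Real.hasDerivAt_sin (ξ (.inl (.inr j)))).const_mul
            (2 * Real.pi * (m : ℕ) * M.spacing)).div_const M.wavelength using 1
          rw [phaseStep]; ring
        have h2 := (((h1.ofReal_comp.const_mul Complex.I).cexp).const_mul
          (Complex.exp (-Complex.I *
            ((2 * Real.pi * (n : ℕ) * ξ (.inl (.inl j)) / (N * M.Ts) : ℝ) : ℂ)))).const_mul
            ((ξ (.inr (.inl j)) : ℂ) + (ξ (.inr (.inr j)) : ℂ) * Complex.I)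
        convert! h2 using 1
        · funext t; simp [phase, pathOf, conj_steering]
        · simp [phase, pathOf, relDeriv, conj_steering]; ring
      · have h2 := (hid.add_const ((ξ (.inr (.inr j)) : ℂ) * Complex.I)).mul_const
          (M.phase N Nt ξ j n m)
        convert! h2 using 1
        funext t; simp [phase, pathOf]
      · have h2 := ((hid.mul_const Complex.I).const_add (ξ (.inr (.inl j)) : ℂ)).mul_const
          (M.phase N Nt ξ j n m)
        convert! h2 using 1
        · funext t; simp [phase, pathOf]
        · simp [relDeriv, pathOf]
    · convert! hasDerivAt_const (𝕜 := ℝ) (ξ i)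
        (((ξ (.inr (.inl k)) : ℂ) + (ξ (.inr (.inr k)) : ℂ) * Complex.I)
          * M.phase N Nt ξ k n m) using 1
      funext t
      have hne : ∀ j : XiIdx K, pathOf j = k → Function.update ξ i t j = ξ j := fun j hj =>
        Function.update_of_ne (fun h => hk (by rw [← h, hj])) _ _
      simp only [phase]
      rw [hne (.inr (.inl k)) rfl, hne (.inr (.inr k)) rfl, hne (.inl (.inl k)) rfl,
        hne (.inl (.inr k)) rfl]
  have h := HasDerivAt.fun_sum (u := Finset.univ) fun k _ => key k
  simpa using h

theorem dObservation_eq (N Nt : ℕ) (ξ : XiIdx K → ℝ) (n : Fin N) (s : Fin Nt → ℂ) (i : XiIdx K) :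
    M.dObservation N Nt ξ n s i
      = ∑ m, M.relDeriv N Nt ξ n m i * M.phase N Nt ξ (pathOf i) n m * s m := by
  refine HasDerivAt.deriv ?_
  exact HasDerivAt.fun_sum fun m _ => (M.hasDerivAt_channel N Nt ξ n m i).mul_const (s m)

/-! ### The Fisher information as a quadratic form -/

theorem fisher_isHermitian (N Nt : ℕ) (ξ : XiIdx K → ℝ) (s : ℕ → Fin N → Fin Nt → ℂ) (G : ℕ) :
    (M.fisher N Nt ξ s G).IsHermitian := by
  refine Matrix.IsHermitian.ext fun i j => ?_
  simp only [fisher, Matrix.of_apply, star_trivial]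
  congr 1
  refine Finset.sum_congr rfl fun n _ => Finset.sum_congr rfl fun g _ => ?_
  rw [← Complex.conj_re]
  congr 1
  rw [map_mul, Complex.conj_conj, mul_comm]

theorem norm_sum_ofReal_mul_sq {ι : Type*} [Fintype ι] (y : ι → ℝ) (d : ι → ℂ) :
    ‖∑ i, (y i : ℂ) * d i‖ ^ 2 = ∑ i, ∑ j, y i * (y j * (conj (d i) * d j).re) := by
  rw [← Complex.ofReal_re (‖∑ i, (y i : ℂ) * d i‖ ^ 2)]
  push_cast
  rw [← Complex.conj_mul', map_sum, Finset.sum_mul_sum, Complex.re_sum]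
  refine Finset.sum_congr rfl fun i _ => ?_
  rw [Complex.re_sum]
  refine Finset.sum_congr rfl fun j _ => ?_
  rw [map_mul, Complex.conj_ofReal, ← Complex.re_ofReal_mul, ← Complex.re_ofReal_mul]
  congr 1
  ring

/-- The quadratic form is the pilot energy received through the directional derivative of the
channel, so positivity and limits reduce to statements about energies. -/
theorem dotProduct_fisher_mulVec (N Nt : ℕ) (ξ : XiIdx K → ℝ) (s : ℕ → Fin N → Fin Nt → ℂ) (G : ℕ)
    (y : XiIdx K → ℝ) :
    y ⬝ᵥ M.fisher N Nt ξ s G *ᵥ y = 2 / M.sigma ^ 2 * ∑ n, ∑ g ∈ Finset.range G,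
      ‖∑ m, (∑ i, (y i : ℂ) * (M.relDeriv N Nt ξ n m i * M.phase N Nt ξ (pathOf i) n m))
        * s g n m‖ ^ 2 := by
  have h : ∀ n g, ∑ m, (∑ i, (y i : ℂ) * (M.relDeriv N Nt ξ n m i
      * M.phase N Nt ξ (pathOf i) n m)) * s g n m
      = ∑ i, (y i : ℂ) * M.dObservation N Nt ξ n (s g n) i := fun n g => by
    simp only [dObservation_eq, Finset.sum_mul, Finset.mul_sum]
    rw [Finset.sum_comm]
    simp only [mul_assoc]
  simp only [h, norm_sum_ofReal_mul_sq]
  simp only [dotProduct, Matrix.mulVec, fisher, Matrix.of_apply,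
    Finset.mul_sum, Finset.sum_mul]
  have e : ∀ i j : XiIdx K, ∀ n g, y i * (2 / M.sigma ^ 2 * (conj (M.dObservation N Nt ξ n (s g n) i)
      * M.dObservation N Nt ξ n (s g n) j).re * y j)
      = 2 / M.sigma ^ 2 * (y i * (y j * (conj (M.dObservation N Nt ξ n (s g n) i)
      * M.dObservation N Nt ξ n (s g n) j).re)) := fun i j n g => by ring
  simp only [e]
  rw [Finset.sum_congr rfl fun i _ => Finset.sum_comm]
  rw [Finset.sum_comm]
  refine Finset.sum_congr rfl fun n _ => ?_
  rw [Finset.sum_congr rfl fun i _ => Finset.sum_comm]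
  rw [Finset.sum_comm]

end Model

/-! ### Schur complements -/

section Schur

variable {m n : Type*} [Fintype m] [Fintype n] [DecidableEq n]

/-- Completing the square in `y`: the Schur complement is the minimum of the form over the nuisance
block. -/
theorem dotProduct_mulVec_eq_schur {J : Matrix (m ⊕ n) (m ⊕ n) ℝ} (hJ : J.PosDef)
    (x : m → ℝ) (y : n → ℝ) :
    Sum.elim x y ⬝ᵥ J *ᵥ Sum.elim x y
      = ((J.toBlocks₂₂⁻¹ * J.toBlocks₂₁) *ᵥ x + y) ⬝ᵥ
          J.toBlocks₂₂ *ᵥ ((J.toBlocks₂₂⁻¹ * J.toBlocks₂₁) *ᵥ x + y)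
        + x ⬝ᵥ (J.toBlocks₁₁ - J.toBlocks₁₂ * J.toBlocks₂₂⁻¹ * J.toBlocks₂₁) *ᵥ x := by
  have hD : J.toBlocks₂₂.PosDef := hJ.submatrix Sum.inr_injective
  have hC : J.toBlocks₂₁ = J.toBlocks₁₂ᴴ := by
    ext i j
    exact (hJ.isHermitian.apply (.inr i) (.inl j)).symm
  let _ : Invertible J.toBlocks₂₂ := hD.isUnit.invertible
  have h := Matrix.schur_complement_eq₂₂ J.toBlocks₁₁ J.toBlocks₁₂ x y hD.isHermitian
  simp only [star_trivial, ← hC, Matrix.fromBlocks_toBlocks, ← Matrix.dotProduct_mulVec] at h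
  exact h

theorem posDef_schur {J : Matrix (m ⊕ n) (m ⊕ n) ℝ} (hJ : J.PosDef) :
    (J.toBlocks₁₁ - J.toBlocks₁₂ * J.toBlocks₂₂⁻¹ * J.toBlocks₂₁).PosDef := by
  have hC : J.toBlocks₂₁ = J.toBlocks₁₂ᴴ := by
    ext i j
    exact (hJ.isHermitian.apply (.inr i) (.inl j)).symm
  have hD : J.toBlocks₂₂.PosDef := hJ.submatrix Sum.inr_injective
  have hA : J.toBlocks₁₁.PosDef := hJ.submatrix Sum.inl_injective
  refine Matrix.PosDef.of_dotProduct_mulVec_pos ?_ fun x hx => ?_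
  · rw [hC]
    exact hA.isHermitian.sub (Matrix.isHermitian_mul_mul_conjTranspose _ hD.isHermitian.inv)
  · have h := dotProduct_mulVec_eq_schur hJ x (-((J.toBlocks₂₂⁻¹ * J.toBlocks₂₁) *ᵥ x))
    rw [add_neg_cancel, Matrix.mulVec_zero, dotProduct_zero, zero_add] at h
    rw [star_trivial, ← h]
    have hne : Sum.elim x (-((J.toBlocks₂₂⁻¹ * J.toBlocks₂₁) *ᵥ x)) ≠ 0 := fun h0 =>
      hx (funext fun i => congrFun h0 (.inl i))
    simpa using hJ.dotProduct_mulVec_pos hne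

/-- Any nuisance direction bounds the effective information from above, which is the side a lower
error bound needs. No inverse has to be computed. -/
theorem schur_apply_le [DecidableEq m] {J : Matrix (m ⊕ n) (m ⊕ n) ℝ} (hJ : J.PosDef) (i : m)
    (y : n → ℝ) :
    (J.toBlocks₁₁ - J.toBlocks₁₂ * J.toBlocks₂₂⁻¹ * J.toBlocks₂₁) i i
      ≤ Sum.elim (Pi.single i 1) y ⬝ᵥ J *ᵥ Sum.elim (Pi.single i 1) y := by
  have hD : J.toBlocks₂₂.PosDef := hJ.submatrix Sum.inr_injective
  rw [dotProduct_mulVec_eq_schur hJ]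
  have h := hD.posSemidef.dotProduct_mulVec_nonneg
    ((J.toBlocks₂₂⁻¹ * J.toBlocks₂₁) *ᵥ Pi.single i 1 + y)
  rw [star_trivial] at h
  have h2 : Pi.single i 1 ⬝ᵥ (J.toBlocks₁₁ - J.toBlocks₁₂ * J.toBlocks₂₂⁻¹ * J.toBlocks₂₁)
      *ᵥ Pi.single i 1 = (J.toBlocks₁₁ - J.toBlocks₁₂ * J.toBlocks₂₂⁻¹ * J.toBlocks₂₁) i i := by
    simp
  linarith

end Schur

/-! ### Positivity of energies and splitting over paths -/

theorem sum_energy_pos {N Nt : ℕ} {s : ℕ → Fin N → Fin Nt → ℂ} {G : ℕ} (hG0 : 0 < G)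
    (hNt : 0 < Nt)
    (hG : ∀ (n : Fin N) (v : Fin Nt → ℂ), (2 * Nt : ℝ)⁻¹ * ∑ m, ‖v m‖ ^ 2
        ≤ (G : ℝ)⁻¹ * ∑ g ∈ Finset.range G, ‖∑ m, v m * s g n m‖ ^ 2)
    (w : Fin N → Fin Nt → ℂ) {n : Fin N} {m : Fin Nt} (hw : w n m ≠ 0) :
    0 < ∑ n, ∑ g ∈ Finset.range G, ‖∑ m, w n m * s g n m‖ ^ 2 := by
  have hG0' : (0 : ℝ) < G := Nat.cast_pos.2 hG0
  have hNt0 : (0 : ℝ) < Nt := Nat.cast_pos.2 hNt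
  refine Finset.sum_pos' (fun n _ => by positivity) ⟨n, Finset.mem_univ _, ?_⟩
  have h1 : 0 < ∑ m, ‖w n m‖ ^ 2 :=
    Finset.sum_pos' (fun _ _ => by positivity) ⟨m, Finset.mem_univ _, by positivity⟩
  have h2 : 0 < (2 * Nt : ℝ)⁻¹ * ∑ m, ‖w n m‖ ^ 2 := by positivity
  exact pos_of_mul_pos_right (h2.trans_le (hG n (w n))) (by positivity)

theorem sum_range_sub_sq (N : ℕ) (c : ℝ) :
    ∑ n ∈ Finset.range N, ((n : ℝ) - c) ^ 2
      = N * (N - 1) * (2 * N - 1) / 6 - c * (N * (N - 1)) + N * c ^ 2 := by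
  induction N with
  | zero => simp
  | succ N ih => rw [Finset.sum_range_succ, ih]; push_cast; ring

/-- The sum of squared deviations of `0, …, N - 1` from their mean. -/
theorem sum_sub_mean_sq (N : ℕ) :
    ∑ n : Fin N, (((n : ℕ) : ℝ) - ((N : ℝ) - 1) / 2) ^ 2 = N * ((N : ℝ) ^ 2 - 1) / 12 := by
  rw [Fin.sum_univ_eq_sum_range (fun n => ((n : ℝ) - ((N : ℝ) - 1) / 2) ^ 2), sum_range_sub_sq]
  ring

/-- The parameter direction in which only the parameters of path `k` change, its delay by `a`, its
angle by `b` and its coefficient by `z`. -/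
def pathVector {K : ℕ} (k : Fin (K + 1)) (a b : ℝ) (z : ℂ) : XiIdx K → ℝ :=
  Sum.elim (Sum.elim (Pi.single k a) (Pi.single k b)) (Sum.elim (Pi.single k z.re) (Pi.single k z.im))

/-- The component of a parameter direction that belongs to path `k`. -/
def pathPart {K : ℕ} (y : XiIdx K → ℝ) (k : Fin (K + 1)) : XiIdx K → ℝ :=
  pathVector k (y (.inl (.inl k))) (y (.inl (.inr k))) ⟨y (.inr (.inl k)), y (.inr (.inr k))⟩

theorem pathPart_apply {K : ℕ} (y : XiIdx K → ℝ) (k : Fin (K + 1)) (i : XiIdx K) :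
    pathPart y k i = if pathOf i = k then y i else 0 := by
  rcases i with (j | j) | (j | j) <;>
  · by_cases h : j = k
    · subst h; simp [pathPart, pathVector, pathOf]
    · simp [pathPart, pathVector, pathOf, h]

/-- If there is no coupling between different paths, a quadratic form is the sum over the paths. -/
theorem dotProduct_mulVec_eq_sum_pathPart {K : ℕ} {J : Matrix (XiIdx K) (XiIdx K) ℝ}
    (hJ : ∀ i j, pathOf i ≠ pathOf j → J i j = 0) (y : XiIdx K → ℝ) :
    y ⬝ᵥ J *ᵥ y = ∑ k, pathPart y k ⬝ᵥ J *ᵥ pathPart y k := by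
  simp only [dotProduct, Matrix.mulVec, pathPart_apply, Finset.mul_sum]
  symm
  rw [Finset.sum_comm]
  refine Finset.sum_congr rfl fun i _ => ?_
  rw [Finset.sum_comm]
  refine Finset.sum_congr rfl fun j _ => ?_
  by_cases h : pathOf i = pathOf j
  · simp [h]
  · simp [hJ _ _ h]

/-! ### Positive definiteness and asymptotic information of one path -/

namespace Model

variable {K : ℕ} (M : Model K)

theorem wavelength_pos : 0 < M.wavelength := div_pos M.c_pos M.carrier_pos

theorem freqStep_pos {N : ℕ} (hN : 0 < N) : 0 < M.freqStep N :=
  div_pos (by positivity) (mul_pos (Nat.cast_pos.2 hN) M.Ts_pos)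

theorem phaseStep_eq (θ : ℝ) : M.phaseStep θ = Real.pi * Real.cos θ := by
  have := M.wavelength_pos
  rw [phaseStep, spacing]
  field_simp

/-- The derivative of the channel along a direction in which only path `k` changes. -/
theorem sum_pathVector_mul (N Nt : ℕ) (φ : Locations K) (n : Fin N) (m : Fin Nt)
    (k : Fin (K + 1)) (a b : ℝ) (z : ℂ) :
    ∑ i, (pathVector k a b z i : ℂ) * (M.relDeriv N Nt (M.virtualParams N φ) n m i
        * M.phase N Nt (M.virtualParams N φ) (pathOf i) n m)
      = (M.gain k * Complex.I * ((M.phaseStep (M.shiftedAod φ k) * (m : ℕ) * b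
          - M.freqStep N * (n : ℕ) * a : ℝ) : ℂ) + z)
        * M.phase N Nt (M.virtualParams N φ) k n m := by
  have hs : ∀ (x : ℝ) (f : Fin (K + 1) → ℂ),
      ∑ j, ((Pi.single k x : Fin (K + 1) → ℝ) j : ℂ) * f j = x * f k := fun x f => by
    rw [Finset.sum_eq_single k]
    · simp
    · intro j _ hj; simp [hj]
    · simp
  have h1 : M.virtualParams N φ (.inr (.inl k)) = (M.gain k).re := rfl
  have h2 : M.virtualParams N φ (.inr (.inr k)) = (M.gain k).im := rfl
  have h3 : M.virtualParams N φ (.inl (.inr k)) = M.shiftedAod φ k := rfl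
  simp only [Fintype.sum_sum_type, pathVector, Sum.elim_inl, Sum.elim_inr, hs, pathOf, relDeriv,
    id, h1, h2, h3, Complex.re_add_im]
  push_cast
  linear_combination (M.phase N Nt (M.virtualParams N φ) k n m) * (Complex.re_add_im z)

theorem norm_sum_pathVector_mul_sq (N Nt : ℕ) (φ : Locations K) (n : Fin N) (m : Fin Nt)
    (k : Fin (K + 1)) (a b : ℝ) (z : ℂ) :
    ‖∑ i, (pathVector k a b z i : ℂ) * (M.relDeriv N Nt (M.virtualParams N φ) n m i
        * M.phase N Nt (M.virtualParams N φ) (pathOf i) n m)‖ ^ 2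
      = ‖M.gain k * Complex.I * ((M.phaseStep (M.shiftedAod φ k) * (m : ℕ) * b
          - M.freqStep N * (n : ℕ) * a : ℝ) : ℂ) + z‖ ^ 2 := by
  rw [sum_pathVector_mul, norm_mul, norm_phase, mul_one]

/-- The parameters of a single path are identifiable. -/
theorem pathVector_eq_zero {N Nt : ℕ} (hN : 2 ≤ N) (hNt : 2 ≤ Nt) {φ : Locations K}
    {k : Fin (K + 1)} (hγ : M.gain k ≠ 0) (hcos : Real.cos (M.shiftedAod φ k) ≠ 0)
    {a b : ℝ} {z : ℂ}
    (h : ∀ (n : Fin N) (m : Fin Nt),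
      M.gain k * Complex.I * ((M.phaseStep (M.shiftedAod φ k) * (m : ℕ) * b
          - M.freqStep N * (n : ℕ) * a : ℝ) : ℂ) + z = 0) :
    pathVector k a b z = 0 := by
  have hω := (M.freqStep_pos (by lia : 0 < N)).ne'
  have hκ : M.phaseStep (M.shiftedAod φ k) ≠ 0 := by
    rw [phaseStep_eq]; exact mul_ne_zero Real.pi_ne_zero hcos
  -- The pairs `(0,0)`, `(1,0)`, `(0,1)` of sub-carrier and antenna isolate `z`, `a` and `b`; this
  -- is where two of each are needed.
  have hz : z = 0 := by
    have := h ⟨0, by lia⟩ ⟨0, by lia⟩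
    simpa using this
  have ha : a = 0 := by
    have := h ⟨1, by lia⟩ ⟨0, by lia⟩
    simpa [hz, hγ, hω] using this
  have hb : b = 0 := by
    have := h ⟨0, by lia⟩ ⟨1, by lia⟩
    simpa [hz, hγ, hκ] using this
  subst hz ha hb
  ext i
  rcases i with (j | j) | (j | j) <;> simp [pathVector]

/-- Orthogonality splits the form into nonnegative single-path energies. For a nonzero direction, a
path carrying a nonzero coordinate contributes strictly, by identifiability and the lower bound on
the sample covariance. -/
theorem eventually_posDef {N Nt : ℕ} (hN : 2 ≤ N) (hNt : 2 ≤ Nt) (hgain : ∀ k, M.gain k ≠ 0)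
    {φ : Locations K} (hcos : ∀ k, Real.cos (M.shiftedAod φ k) ≠ 0)
    {s : ℕ → Fin N → Fin Nt → ℂ} (hs : PilotsConverge s) :
    ∀ᶠ G : ℕ in atTop, M.PathsOrthogonal N Nt φ s G → (M.virtualFisher N Nt φ s G).PosDef := by
  filter_upwards [hs.eventually_energy_ge (by lia), eventually_gt_atTop 0] with G hG hG0 horth
  have hσ := M.sigma_pos
  refine Matrix.PosDef.of_dotProduct_mulVec_pos (M.fisher_isHermitian _ _ _ _ _) fun y hy => ?_
  rw [star_trivial, dotProduct_mulVec_eq_sum_pathPart horth]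
  obtain ⟨i, hi⟩ := Function.ne_iff.1 hy
  refine Finset.sum_pos' (fun k _ => ?_) ⟨pathOf i, Finset.mem_univ _, ?_⟩
  · rw [virtualFisher, dotProduct_fisher_mulVec]
    positivity
  · rw [virtualFisher, dotProduct_fisher_mulVec]
    have hne : ∃ (n : Fin N) (m : Fin Nt), ∑ i', (pathPart y (pathOf i) i' : ℂ)
        * (M.relDeriv N Nt (M.virtualParams N φ) n m i'
          * M.phase N Nt (M.virtualParams N φ) (pathOf i') n m) ≠ 0 := by
      by_contra! hc
      have h0 : pathPart y (pathOf i) = 0 :=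
        M.pathVector_eq_zero hN hNt (hgain _) (hcos _) fun n m => by
          have := hc n m
          rw [pathPart] at this
          rw [← norm_eq_zero, ← sq_eq_zero_iff, ← norm_sum_pathVector_mul_sq, this]
          simp
      have h1 := congrFun h0 i
      rw [pathPart_apply, if_pos rfl] at h1
      exact hi h1
    obtain ⟨n, m, hnm⟩ := hne
    exact mul_pos (by positivity) (sum_energy_pos hG0 (by lia) hG _ hnm)

/-- The limit of the averaged Fisher information in a direction of a single path. -/
theorem tendsto_fisher_pathVector {N Nt : ℕ} (φ : Locations K)
    {s : ℕ → Fin N → Fin Nt → ℂ} (hs : PilotsConverge s) (k : Fin (K + 1)) (a b : ℝ) (z : ℂ) :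
    Tendsto (fun G : ℕ => (G : ℝ)⁻¹ *
        (pathVector k a b z ⬝ᵥ M.virtualFisher N Nt φ s G *ᵥ pathVector k a b z)) atTop
      (𝓝 (2 / M.sigma ^ 2 * ∑ n : Fin N, (Nt : ℝ)⁻¹ * ∑ m : Fin Nt,
        ‖M.gain k * Complex.I * ((M.phaseStep (M.shiftedAod φ k) * (m : ℕ) * b
          - M.freqStep N * (n : ℕ) * a : ℝ) : ℂ) + z‖ ^ 2)) := by
  have e : ∀ G : ℕ, (G : ℝ)⁻¹ *
      (pathVector k a b z ⬝ᵥ M.virtualFisher N Nt φ s G *ᵥ pathVector k a b z)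
      = 2 / M.sigma ^ 2 * ∑ n : Fin N, (G : ℝ)⁻¹ * ∑ g ∈ Finset.range G,
        ‖∑ m, (∑ i, (pathVector k a b z i : ℂ) * (M.relDeriv N Nt (M.virtualParams N φ) n m i
        * M.phase N Nt (M.virtualParams N φ) (pathOf i) n m)) * s g n m‖ ^ 2 := fun G => by
    rw [virtualFisher, dotProduct_fisher_mulVec, ← Finset.mul_sum]
    ring
  simp only [e, ← norm_sum_pathVector_mul_sq]
  exact (tendsto_finsetSum _ fun n _ => hs.tendsto_energy _ n).const_mul _

/-- The asymptotic effective information on the delay of path `k`, per pilot. -/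
noncomputable def delayInfo (N : ℕ) (k : Fin (K + 1)) : ℝ :=
  ‖M.gain k‖ ^ 2 * M.freqStep N ^ 2 * (N * ((N : ℝ) ^ 2 - 1)) / (6 * M.sigma ^ 2)

/-- The asymptotic effective information on the angle `θ` of path `k`, per pilot. -/
noncomputable def angleInfo (N Nt : ℕ) (θ : ℝ) (k : Fin (K + 1)) : ℝ :=
  ‖M.gain k‖ ^ 2 * M.phaseStep θ ^ 2 * (N * ((Nt : ℝ) ^ 2 - 1)) / (6 * M.sigma ^ 2)

theorem norm_gain_mul_I_mul_sq (k : Fin (K + 1)) (x : ℝ) :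
    ‖M.gain k * Complex.I * (x : ℂ)‖ ^ 2 = ‖M.gain k‖ ^ 2 * x ^ 2 := by
  rw [norm_mul, norm_mul, Complex.norm_I, mul_one, Complex.norm_real, mul_pow, Real.norm_eq_abs,
    sq_abs]

/-- A phase rotation of the gain absorbs the mean phase change. It replaces `n` by `n - (N - 1)/2`,
the least-squares choice, and the centred sum of squares is `N (N² - 1) / 12`. -/
theorem exists_delay_direction {N Nt : ℕ} (hNt : 0 < Nt) (φ : Locations K)
    {s : ℕ → Fin N → Fin Nt → ℂ} (hs : PilotsConverge s) (k : Fin (K + 1)) :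
    ∃ z : ℂ, Tendsto (fun G : ℕ => (G : ℝ)⁻¹ *
        (pathVector k 1 0 z ⬝ᵥ M.virtualFisher N Nt φ s G *ᵥ pathVector k 1 0 z)) atTop
      (𝓝 (M.delayInfo N k)) := by
  have hNt0 : (0 : ℝ) < Nt := Nat.cast_pos.2 hNt
  have hσ := M.sigma_pos
  refine ⟨M.gain k * Complex.I * ((M.freqStep N * (((N : ℝ) - 1) / 2) : ℝ) : ℂ), ?_⟩
  convert! M.tendsto_fisher_pathVector φ hs k 1 0 _ using 2
  simp only [← mul_add, ← Complex.ofReal_add, norm_gain_mul_I_mul_sq]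
  have e : ∀ (n : Fin N) (m : Fin Nt), (M.phaseStep (M.shiftedAod φ k) * ((m : ℕ) : ℝ) * 0
      - M.freqStep N * ((n : ℕ) : ℝ) * 1 + M.freqStep N * (((N : ℝ) - 1) / 2)) ^ 2
      = M.freqStep N ^ 2 * (((n : ℕ) : ℝ) - ((N : ℝ) - 1) / 2) ^ 2 := fun n m => by ring
  simp only [e, Finset.sum_const, Finset.card_univ, Fintype.card_fin, nsmul_eq_mul,
    ← Finset.mul_sum, sum_sub_mean_sq, delayInfo]
  field_simp
  ring

/-- The same centring, now over antennas. The factor `1/Nt` from the pilots cancels the `Nt` of the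
centred sum, and summing over sub-carriers restores the factor `N`. -/
theorem exists_angle_direction {N Nt : ℕ} (hNt : 0 < Nt) (φ : Locations K)
    {s : ℕ → Fin N → Fin Nt → ℂ} (hs : PilotsConverge s) (k : Fin (K + 1)) :
    ∃ z : ℂ, Tendsto (fun G : ℕ => (G : ℝ)⁻¹ *
        (pathVector k 0 1 z ⬝ᵥ M.virtualFisher N Nt φ s G *ᵥ pathVector k 0 1 z)) atTop
      (𝓝 (M.angleInfo N Nt (M.shiftedAod φ k) k)) := by
  have hNt0 : (0 : ℝ) < Nt := Nat.cast_pos.2 hNt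
  have hσ := M.sigma_pos
  set κ := M.phaseStep (M.shiftedAod φ k) with hκ
  refine ⟨M.gain k * Complex.I * ((-(κ * (((Nt : ℝ) - 1) / 2)) : ℝ) : ℂ), ?_⟩
  convert! M.tendsto_fisher_pathVector φ hs k 0 1 _ using 2
  simp only [← mul_add, ← Complex.ofReal_add, norm_gain_mul_I_mul_sq]
  have e : ∀ (n : Fin N) (m : Fin Nt), (κ * ((m : ℕ) : ℝ) * 1
      - M.freqStep N * ((n : ℕ) : ℝ) * 0 + -(κ * (((Nt : ℝ) - 1) / 2))) ^ 2
      = κ ^ 2 * (((m : ℕ) : ℝ) - ((Nt : ℝ) - 1) / 2) ^ 2 := fun n m => by ring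
  simp only [← hκ, e, Finset.sum_const, Finset.card_univ, Fintype.card_fin, nsmul_eq_mul,
    ← Finset.mul_sum, sum_sub_mean_sq, angleInfo]
  field_simp
  ring

theorem one_lt_sq_of_two_le {n : ℕ} (h : 2 ≤ n) : (0 : ℝ) < (n : ℝ) ^ 2 - 1 := by
  have : (2 : ℝ) ≤ n := by exact_mod_cast h
  nlinarith

theorem delayInfo_pos {N : ℕ} (hN : 2 ≤ N) {k : Fin (K + 1)} (hγ : M.gain k ≠ 0) :
    0 < M.delayInfo N k := by
  have := M.sigma_pos
  have := M.freqStep_pos (by lia : 0 < N)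
  have := one_lt_sq_of_two_le hN
  have : (0 : ℝ) < N := Nat.cast_pos.2 (by lia)
  unfold delayInfo
  positivity

theorem angleInfo_pos {N Nt : ℕ} (hN : 2 ≤ N) (hNt : 2 ≤ Nt) {k : Fin (K + 1)}
    (hγ : M.gain k ≠ 0) {θ : ℝ} (hcos : Real.cos θ ≠ 0) : 0 < M.angleInfo N Nt θ k := by
  have := M.sigma_pos
  have := one_lt_sq_of_two_le hNt
  have : (0 : ℝ) < N := Nat.cast_pos.2 (by lia)
  unfold angleInfo
  rw [phaseStep_eq]
  have := Real.pi_pos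
  positivity

theorem div_sub_le_of_averaged {G A B x y ψ f₁ f₂ q₁ q₂ : ℝ} (hG : 0 < G) (hA : 0 < A)
    (hB : 0 < B) (hx : 0 ≤ x) (hy : 0 ≤ y) (hf₁ : 0 < f₁) (hf₂ : 0 < f₂) (h₁ : f₁ ≤ q₁)
    (h₂ : f₂ ≤ q₂) (h : x / A + y / B - ψ ≤ x / (G⁻¹ * q₁) + y / (G⁻¹ * q₂)) :
    x / (G * A) + y / (G * B) - ψ / G ≤ x / f₁ + y / f₂ := by
  have hq₁ := hf₁.trans_le h₁
  have hq₂ := hf₂.trans_le h₂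
  calc _ = (x / A + y / B - ψ) / G := by field_simp
    _ ≤ (x / (G⁻¹ * q₁) + y / (G⁻¹ * q₂)) / G := by gcongr
    _ = x / q₁ + y / q₂ := by field_simp
    _ ≤ _ := by gcongr

/-- Eventually the Cramér–Rao terms exceed their asymptotic values, up to a term of order `1/G`. -/
theorem eventually_bound_le {N Nt : ℕ} (hN : 2 ≤ N) (hNt : 2 ≤ Nt)
    {φ : Locations K} {k : Fin (K + 1)} (hγ : M.gain k ≠ 0)
    (hcos : Real.cos (M.shiftedAod φ k) ≠ 0)
    {s : ℕ → Fin N → Fin Nt → ℂ} (hs : PilotsConverge s) (u v : ℝ) {ψ : ℝ} (hψ : 0 < ψ) :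
    ∀ᶠ G : ℕ in atTop, (M.virtualFisher N Nt φ s G).PosDef →
      u ^ 2 / (G * M.delayInfo N k) + v ^ 2 / (G * M.angleInfo N Nt (M.shiftedAod φ k) k) - ψ / G
        ≤ u ^ 2 / M.effectiveFisher N Nt φ s G (.inl k) (.inl k)
          + v ^ 2 / M.effectiveFisher N Nt φ s G (.inr k) (.inr k) := by
  obtain ⟨z₁, h₁⟩ := M.exists_delay_direction (by lia) φ hs k
  obtain ⟨z₂, h₂⟩ := M.exists_angle_direction (by lia) φ hs k
  have hA := M.delayInfo_pos hN hγ
  have hB := M.angleInfo_pos hN hNt hγ hcos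
  set A := M.delayInfo N k
  set B := M.angleInfo N Nt (M.shiftedAod φ k) k
  have hlim := ((tendsto_const_nhds (x := u ^ 2)).div h₁ hA.ne').add
    ((tendsto_const_nhds (x := v ^ 2)).div h₂ hB.ne')
  -- The limit strictly exceeds its value minus `ψ`, so the averaged terms eventually do as well;
  -- dividing by `G` produces `ψ / G`.
  have hev := hlim.eventually (lt_mem_nhds (sub_lt_self (u ^ 2 / A + v ^ 2 / B) hψ))
  filter_upwards [hev, eventually_gt_atTop 0] with G hG hG0 hJ
  have hG0' : (0 : ℝ) < G := Nat.cast_pos.2 hG0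
  have hS := posDef_schur hJ
  have hy₁ : pathVector k 1 0 z₁ = Sum.elim (Pi.single (.inl k) 1)
      (Sum.elim (Pi.single k z₁.re) (Pi.single k z₁.im)) := by
    ext i; rcases i with (j | j) | (j | j) <;> simp [pathVector, Pi.single_apply]
  have hy₂ : pathVector k 0 1 z₂ = Sum.elim (Pi.single (.inr k) 1)
      (Sum.elim (Pi.single k z₂.re) (Pi.single k z₂.im)) := by
    ext i; rcases i with (j | j) | (j | j) <;> simp [pathVector, Pi.single_apply]
  have hle₁ := schur_apply_le hJ (.inl k) (Sum.elim (Pi.single k z₁.re) (Pi.single k z₁.im))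
  have hle₂ := schur_apply_le hJ (.inr k) (Sum.elim (Pi.single k z₂.re) (Pi.single k z₂.im))
  rw [← hy₁] at hle₁
  rw [← hy₂] at hle₂
  change M.effectiveFisher N Nt φ s G (.inl k) (.inl k) ≤ _ at hle₁
  change M.effectiveFisher N Nt φ s G (.inr k) (.inr k) ≤ _ at hle₂
  have hp₁ : 0 < M.effectiveFisher N Nt φ s G (.inl k) (.inl k) := hS.diag_pos
  have hp₂ : 0 < M.effectiveFisher N Nt φ s G (.inr k) (.inr k) := hS.diag_pos
  exact div_sub_le_of_averaged hG0' hA hB (sq_nonneg u) (sq_nonneg v) hp₁ hp₂ hle₁ hle₂ hG.le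

theorem C₁_eq {N : ℕ} (hN : 2 ≤ N) {k : Fin (K + 1)} (hγ : M.gain k ≠ 0) {G : ℕ} (hG : 0 < G)
    (ψ : ℝ) : M.C₁ N k G ψ = M.c ^ 2 / (G * M.delayInfo N k) - ψ / G := by
  have := M.sigma_pos
  have := M.Ts_pos
  have := one_lt_sq_of_two_le hN
  have : (0 : ℝ) < N := Nat.cast_pos.2 (by lia)
  have : (0 : ℝ) < G := Nat.cast_pos.2 hG
  have := Real.pi_pos
  have : 0 < ‖M.gain k‖ := norm_pos_iff.2 hγ
  rw [C₁, delayInfo, freqStep]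
  congr 1
  field_simp
  ring

/-- At half-wavelength spacing the phase step is `π cos θ`; its square in the information is the
source of `1 / cos² θ`. -/
theorem C₂_eq {N Nt : ℕ} (hN : 2 ≤ N) (hNt : 2 ≤ Nt) {k : Fin (K + 1)} (hγ : M.gain k ≠ 0)
    {G : ℕ} (hG : 0 < G) {θ : ℝ} (hcos : Real.cos θ ≠ 0) (D : ℝ) :
    M.C₂ N Nt k G * D ^ 2 / Real.cos θ ^ 2
      = (M.c * D) ^ 2 / (G * M.angleInfo N Nt θ k) := by
  have := M.sigma_pos
  have := M.wavelength_pos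
  have := one_lt_sq_of_two_le hNt
  have : (0 : ℝ) < N := Nat.cast_pos.2 (by lia)
  have : (0 : ℝ) < G := Nat.cast_pos.2 hG
  have := Real.pi_pos
  have : 0 < ‖M.gain k‖ := norm_pos_iff.2 hγ
  rw [C₂, angleInfo, phaseStep_eq, spacing]
  field_simp
  ring

end Model

end DAIS
-- The bound for random pilots
theorem proposition2 {Ω : Type*} [MeasurableSpace Ω] (P : Measure Ω) [IsProbabilityMeasure P]
    (K N Nt : ℕ) (hN : 2 ≤ N) (hNt : 2 ≤ Nt)
    (M : DAIS.Model K) (hgain : ∀ k, M.gain k ≠ 0)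
    (φ : DAIS.Locations K) (hfront : M.InFront φ)
    (hcos : ∀ k, Real.cos (M.shiftedAod φ k) ≠ 0)
    (kmin : Fin (K + 1)) (hkmin : M.IsFirstPath N φ kmin)
    (s : ℕ → Fin N → Ω → Fin Nt → ℂ) (hs : DAIS.IsPilotSequence P s)
    (ψ : ℝ) (hψ : 0 < ψ) :
    ∀ᵐ ω ∂P, ∃ 𝒢 : ℕ, 0 < 𝒢 ∧ ∀ G : ℕ, 𝒢 ≤ G →
      M.PathsOrthogonal N Nt φ (fun g n => s g n ω) G →
      (M.virtualFisher N Nt φ (fun g n => s g n ω) G).PosDef ∧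
      (∃! φbar : DAIS.Locations K,
        M.IsPseudoTrue N (M.errorCov N Nt φ (fun g n => s g n ω) G) φ φbar) ∧
      ∀ φbar : DAIS.Locations K,
        M.IsPseudoTrue N (M.errorCov N Nt φ (fun g n => s g n ω) G) φ φbar →
        (∀ phat : EuclideanSpace ℝ (DAIS.EtaIdx K) → DAIS.Plane, Measurable phat →
          M.MisspecifiedUnbiased N (M.errorCov N Nt φ (fun g n => s g n ω) G) φ phat →
          ENNReal.ofReal
              (M.C₁ N kmin G ψ
                + M.C₂ N Nt kmin G * M.shiftedToa N φ kmin ^ 2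
                  / Real.cos (M.shiftedAod φ kmin) ^ 2
                + ‖φbar 0 - φ 0‖ ^ 2)
            ≤ M.mse N (M.errorCov N Nt φ (fun g n => s g n ω) G) φ phat) ∧
        M.C₁ N kmin G ψ
            + M.C₂ N Nt kmin G * M.shiftedToa N φ kmin ^ 2
              / Real.cos (M.shiftedAod φ kmin) ^ 2
            + ‖φbar 0 - φ 0‖ ^ 2
          = M.C₁ N kmin G ψ
            + M.C₂ N Nt kmin G
                * DAIS.wrap 0 (N * M.Ts) (M.toa φ kmin + M.shiftDelay) ^ 2
              / Real.cos (Real.arcsin (DAIS.wrap (-1) 1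
                  (Real.sin (M.aod φ kmin) + Real.sin M.shiftAngle))) ^ 2
            + (M.z 0 - φ 0 0
                - M.c * DAIS.wrap 0 (N * M.Ts) (M.toa φ kmin + M.shiftDelay)
                  * Real.cos (Real.arcsin (DAIS.wrap (-1) 1
                      (Real.sin (M.aod φ kmin) + Real.sin M.shiftAngle)))) ^ 2
            + (M.z 1 - φ 0 1
                - M.c * DAIS.wrap 0 (N * M.Ts) (M.toa φ kmin + M.shiftDelay)
                  * DAIS.wrap (-1) 1
                      (Real.sin (M.aod φ kmin) + Real.sin M.shiftAngle)) ^ 2 := by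
  filter_upwards [hs.ae_pilotsConverge] with ω hω
  have hN0 : 0 < N := by lia
  have hΘ := fun j => M.shiftedAod_mem (hcos j)
  obtain ⟨G₀, hG₀⟩ := eventually_atTop.1 ((M.eventually_posDef hN hNt hgain hcos hω).and
    (M.eventually_bound_le hN hNt (hgain kmin) (hcos kmin) hω M.c
      (M.c * M.shiftedToa N φ kmin) hψ))
  -- Taking at least one pilot keeps `G` positive, so that the divisions by `G` are genuine.
  refine ⟨max G₀ 1, by positivity, fun G hG horth => ?_⟩
  obtain ⟨hpd, hbound⟩ := hG₀ G (le_of_max_le_left hG)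
  have hGpos : 0 < G := le_of_max_le_right hG
  have hJ := hpd horth
  have hF : (M.effectiveFisher N Nt φ (fun g n => s g n ω) G).PosDef := DAIS.posDef_schur hJ
  refine ⟨hJ, ⟨M.explained N φ kmin, M.isPseudoTrue_explained hN0 _ hkmin hΘ,
    fun χ hχ => hχ.eq_explained hN0 hkmin hΘ⟩, fun φbar hφbar => ?_⟩
  obtain rfl := hφbar.eq_explained hN0 hkmin hΘ
  refine ⟨fun phat hmeas hunb => ?_, ?_⟩
  · refine le_trans (ENNReal.ofReal_le_ofReal ?_)
      (M.ofReal_le_mse hN0 hF hfront hkmin hcos hmeas hunb)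
    rw [M.C₁_eq hN (hgain kmin) hGpos, M.C₂_eq hN hNt (hgain kmin) hGpos (hcos kmin)]
    linarith [hbound hJ]
  · rw [DAIS.Plane.norm_sq, M.explained_zero]
    simp only [PiLp.sub_apply, PiLp.smul_apply, smul_eq_mul, DAIS.dir_zero_apply,
      DAIS.dir_one_apply, M.sin_shiftedAod]
    simp only [DAIS.Model.shiftedToa, DAIS.Model.shiftedAod]
    ring
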